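/- **Notation.** $\mathfrak E$ is a finite-dimensional complex Hilbert space. A *Herglotz–Nevanlinna function* in $\mathfrak E$ is a holomorphic function $V$ on $\mathbb C\setminus\mathbb R$ whose values are operators in $\mathfrak E$, with $V(z)^*=V(\bar z)$ and $\operatorname{Im}V(z)\ge 0$ for $\operatorname{Im}z>0$. $[\mathfrak H_1,\mathfrak H_2]$ denotes the bounded linear operators from $\mathfrak H_1$ to $\mathfrak H_2$. *Rigged space.* Let $A$ be a closed Hermitian, not necessarily densely defined, operator in a complex Hilbert space $\mathfrak H$, i.e. $(Ax,y)=(x,Ay)$ for $x,y\in\operatorname{dom}A$. Regard $A$ as an operator from $\mathfrak H_0=\overline{\operatorname{dom}A}$ to $\mathfrak H$, so that $A^*$ acts from $\mathfrak H$ to $\mathfrak H_0$. Let $\mathfrak H_+=\operatorname{dom}A^*$ with $(f,g)_+=(f,g)+(A^*f,A^*g)$, and let $\mathfrak H_-$ be the space of continuous conjugate-linear functionals on $\mathfrak H_+$ with the dual norm, so that $\mathfrak H_+\subset\mathfrak H\subset\mathfrak H_-$, where $h\in\mathfrak H$ is identified with $f\mapsto(h,f)$. The adjoint $\mathbb B^*\in[\mathfrak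 H_+,\mathfrak H_-]$ of $\mathbb B\in[\mathfrak H_+,\mathfrak H_-]$ and the adjoint $K^*\in[\mathfrak H_+,\mathfrak E]$ of $K\in[\mathfrak E,\mathfrak H_-]$ are taken with respect to this pairing; $\mathbb B_R=\frac12(\mathbb B+\mathbb B^*)$. For an operator $S$ in $\mathfrak H$, $S\subset\mathbb B$ means that $\operatorname{dom}S\subset\mathfrak H_+$ and $\mathbb Bx=Sx$ on $\operatorname{dom}S$. *Extensions.* $\mathbb B\in[\mathfrak H_+,\mathfrak H_-]$ is a *self-adjoint bi-extension* of $A$ if $A\subset\mathbb B$, $\mathbb B=\mathbb B^*$, and $\{(x,\mathbb Bx): x\in\mathfrak H_+,\ \mathbb Bx\in\mathfrak H\}$ is the graph of a self-adjoint extension of $A$ in $\mathfrak H$. $\Omega_A$ is the class of closed densely defined operators $T$ in $\mathfrak H$ with $A=T\cap T^*$ for which $-i$ is a regular point. $\mathbb B$ is a *correct $(*)$-extension* of $T\in\Omega_A$ if $T\subset\mathbb B$, $T^*\subset\mathbb B^*$, and $\mathbb B_R$ is a self-adjoint bi-extension of $A$. *Systems.* For $\mathbb B\in[\mathfrak H_+,\mathfrak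 H_-]$, $F_+\in[\mathfrak H,\mathfrak H]$ and $K\in[\mathfrak E,\mathfrak H_-]$, let $\rho(\mathbb B,F_+,K)$ be the set of all $z\in\mathbb C$ for which $\mathbb B-zF_+:\mathfrak H_+\to\mathfrak H_-$ is injective and $(\mathbb B-zF_+)^{-1}$ is defined on $\mathfrak H+\operatorname{ran}K$ and continuous there from the norm of $\mathfrak H_-$ to the norm of $\mathfrak H$. The data $(\mathbb D,F_+,K)$ form a *$\Delta_+$-system (impedance system)* if $\mathbb D\in[\mathfrak H_+,\mathfrak H_-]$ is a self-adjoint bi-extension of $A$, $K\in[\mathfrak E,\mathfrak H_-]$ with $\ker K=\{0\}$, $F_+$ is an orthogonal projection in $\mathfrak H$ and in $\mathfrak H_+$, and $\rho(\mathbb D,F_+,K)$ is open. The data $(\mathbb A,F_+,K,J)$ form an *$F_+$-system* with main operator $\mathbb A$ if 1. $\mathbb A\in[\mathfrak H_+,\mathfrak H_-]$ is a correct $(*)$-extension of some $T\in\Omega_A$; 2. $J=J^*=J^{-1}$ in $\mathfrak E$; 3. $\mathbb A-\mathbb A^*=2iKJK^*$, where $K\in[\mathfrak E,\mathfrak H_-]$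 and $\ker K=\{0\}$; 4. $F_+$ is an orthogonal projection in $\mathfrak H$ and in $\mathfrak H_+$; 5. $\rho(\mathbb A,F_+,K)$ is open; 6. $\rho(\mathbb A_R,F_+,K)$ and $\rho(\mathbb A,F_+,K)\cap\rho(\mathbb A_R,F_+,K)$ are open; 7. $z\in\rho(\mathbb A,F_+,K)$ implies $\bar z\in\rho(\mathbb A^*,F_+,K)$, and $z\in\rho(\mathbb A_R,F_+,K)$ implies $\bar z\in\rho(\mathbb A_R,F_+,K)$. It is a *scattering* $F_+$-system if $J=I$. Its *transfer function* is $W(z)=I-2iK^*(\mathbb A-zF_+)^{-1}KJ$, $z\in\rho(\mathbb A,F_+,K)$. **Theorem.** Let $V$ be a Herglotz–Nevanlinna function in $\mathfrak E$ with the integral representation $$V(z)=Q+zL+\int_{\mathbb R}\left(\frac1{t-z}-\frac t{1+t^2}\right)d\Sigma(t),\qquad z\in\mathbb C\setminus\mathbb R,$$ where $Q=Q^*$, $L\ge0$ is invertible, and $\Sigma$ is a nondecreasing function on $\mathbb R$ with self-adjoint values in $\mathfrak E$ and $\int_{\mathbb R}\frac{(d\Sigma(t)x,x)}{1+t^2}<\infty$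 for all $x\in\mathfrak E$. Then there are a complex Hilbert space $\mathfrak H$, a closed Hermitian operator $A$ in $\mathfrak H$ with rigged space $\mathfrak H_+\subset\mathfrak H\subset\mathfrak H_-$, operators $\mathbb A,\mathbb D\in[\mathfrak H_+,\mathfrak H_-]$ and $K\in[\mathfrak E,\mathfrak H_-]$, and an operator $F_+$ in $\mathfrak H$ such that: (a) $(\mathbb A,F_+,K,I)$ is a scattering $F_+$-system, $(\mathbb D,F_+,K)$ is a $\Delta_+$-system, $\mathbb A=\mathbb D+iKK^*$ and $\mathbb A_R=\mathbb D$; (b) every $z\in\mathbb C\setminus\mathbb R$ belongs to $\rho(\mathbb D,F_+,K)$, and $V(z)=K^*(\mathbb D-zF_+)^{-1}K$; (c) $\rho(\mathbb A,F_+,K)$ contains the open lower half-plane and every $z\in\mathbb C\setminus\mathbb R$ for which $I+iV(z)$ is invertible; (d) for every nonreal $z\in\rho(\mathbb A,F_+,K)$ the operator $W(z)+I$ is invertible and $$V(z)=i\,[W(z)+I]^{-1}[W(z)-I],$$ where $W(z)=I-2iK^*(\mathbb A-zF_+)^{-1}K$ is the transfer function of the system in (a). -/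

import Mathlib

open scoped InnerProductSpace ComplexConjugate
open MeasureTheory

universe u

namespace FPlusRealization

noncomputable section

/-! ### Matrix-valued Herglotz–Nevanlinna functions and matrix-valued distribution functions -/

section Functions

variable {E : Type u} [NormedAddCommGroup E] [InnerProductSpace ℂ E]

/-- Herglotz–Nevanlinna functions: holomorphic on `ℂ \ ℝ`, symmetric with respect to the real axis,
with nonnegative imaginary part on the upper half-plane. Only the values at nonreal points matter. -/
structure IsHerglotzNevanlinna [CompleteSpace E] (V : ℂ → E →L[ℂ] E) : Prop where
  holomorphic : DifferentiableOn ℂ V {z : ℂ | z.im ≠ 0}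
  symmetric : ∀ z : ℂ, z.im ≠ 0 → ContinuousLinearMap.adjoint (V z) = V (conj z)
  im_nonneg : ∀ z : ℂ, 0 < z.im → ∀ x : E, 0 ≤ (⟪x, V z x⟫_ℂ).im

variable (E) in
/-- A nondecreasing function `Σ` on `ℝ` whose values are self-adjoint operators in `E`. -/
structure MonotoneOperatorFunction where
  /-- the underlying function -/
  toFun : ℝ → E →L[ℂ] E
  symm : ∀ t, (toFun t).IsSymmetric
  mono : ∀ s t, s ≤ t → (toFun t - toFun s).IsPositive

/-- For every `x` the scalar function `t ↦ (Σ(t) x, x)` is nondecreasing. -/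
theorem MonotoneOperatorFunction.monotone_quad (S : MonotoneOperatorFunction E) (x : E) :
    Monotone fun t : ℝ => (⟪x, S.toFun t x⟫_ℂ).re := by
  intro s t hst
  have h := (S.mono s t hst).2 x
  have h2 : (S.toFun t - S.toFun s).reApplyInnerSelf x
      = (⟪x, S.toFun t x⟫_ℂ).re - (⟪x, S.toFun s x⟫_ℂ).re := by
    rw [ContinuousLinearMap.reApplyInnerSelf_apply, ← inner_re_symm]
    simp [inner_sub_right]
  rw [h2] at h
  simpa using h

/-- The Lebesgue–Stieltjes measure `(dΣ(t) x, x)`. -/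
def MonotoneOperatorFunction.quadMeasure (S : MonotoneOperatorFunction E) (x : E) : Measure ℝ :=
  (S.monotone_quad x).stieltjesFunction.measure

/-- `∫ (dΣ(t) x, x) / (1 + t²) < ∞` for all `x`. -/
def MonotoneOperatorFunction.IsNevanlinna (S : MonotoneOperatorFunction E) : Prop :=
  ∀ x : E, Integrable (fun t : ℝ => 1 / (1 + t ^ 2)) (S.quadMeasure x)

/-- The integral representation
`V(z) = Q + z L + ∫ (1 / (t - z) - t / (1 + t²)) dΣ(t)`, `z ∈ ℂ \ ℝ`. Both sides are operators on a
complex inner product space, so the identity is expressed through the quadratic forms. -/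
def HasNevanlinnaRepresentation (V : ℂ → E →L[ℂ] E) (Q L : E →L[ℂ] E)
    (S : MonotoneOperatorFunction E) : Prop :=
  ∀ z : ℂ, z.im ≠ 0 → ∀ x : E,
    ⟪x, V z x⟫_ℂ = ⟪x, Q x⟫_ℂ + z * ⟪x, L x⟫_ℂ
      + ∫ t : ℝ, (1 / ((t : ℂ) - z) - (t : ℂ) / (1 + (t : ℂ) ^ 2)) ∂(S.quadMeasure x)

end Functions

/-! ### The rigged Hilbert space of a Hermitian operator -/

section Rigged

variable {H : Type u} [NormedAddCommGroup H] [InnerProductSpace ℂ H]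

/-- A closed Hermitian operator in `H`; it need not be densely defined. -/
structure IsClosedHermitian (A : H →ₗ.[ℂ] H) : Prop where
  closed : A.IsClosed
  hermitian : ∀ x y : A.domain, ⟪A x, (y : H)⟫_ℂ = ⟪(x : H), A y⟫_ℂ

/-- The space `H₊`, as the graph of the adjoint `A*`. Here `A` acts from `H₀`, the closure of
`dom A`, to `H`, so that `A*` acts from `H` to `H₀`. The pair `(y, w)` stands for `y ∈ dom A*`
with `A* y = w`; the inner product inherited from `H × H` is the graph inner product
`(y, y') + (A* y, A* y')`. -/
def plusSpace (A : H →ₗ.[ℂ] H) : Submodule ℂ (WithLp 2 (H × H)) where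
  carrier := {p | p.snd ∈ A.domain.topologicalClosure ∧
    ∀ x : A.domain, ⟪A x, p.fst⟫_ℂ = ⟪(x : H), p.snd⟫_ℂ}
  zero_mem' := by simp
  add_mem' := by
    rintro p q ⟨hp, hp'⟩ ⟨hq, hq'⟩
    refine ⟨?_, fun x => ?_⟩
    · simpa using Submodule.add_mem _ hp hq
    · simp [hp' x, hq' x]
  smul_mem' := by
    rintro c p ⟨hp, hp'⟩
    refine ⟨?_, fun x => ?_⟩
    · simpa using Submodule.smul_mem _ c hp
    · simp [hp' x]

/-- The space `H₊ = dom A*` with the graph inner product. -/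
abbrev HPlus (A : H →ₗ.[ℂ] H) : Type u := plusSpace A

/-- The space `H₋` of continuous (conjugate-linear) functionals on `H₊`, with the dual norm. The
value of `φ ∈ H₋` at `f ∈ H₊` is the pairing `(φ, f)`, which is linear in `φ`. -/
abbrev HMinus (A : H →ₗ.[ℂ] H) : Type u := HPlus A →L⋆[ℂ] ℂ

/-- The inclusion of `H₊` in `H`. -/
def inclPlus (A : H →ₗ.[ℂ] H) : HPlus A →L[ℂ] H :=
  (WithLp.fstL 2 ℂ H H).comp (plusSpace A).subtypeL

/-- The inclusion of `H` in `H₋`: the vector `h` is the functional `f ↦ (h, f)`. -/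
def inclMinus (A : H →ₗ.[ℂ] H) : H →L[ℂ] HMinus A :=
  LinearMap.mkContinuous
    { toFun := fun h => (((innerSL ℂ : H →L⋆[ℂ] H →L[ℂ] ℂ).flip h).comp (inclPlus A) :
        HPlus A →L⋆[ℂ] ℂ)
      map_add' := fun a b => by ext f; simp
      map_smul' := fun c a => by ext f; simp }
    ‖inclPlus A‖ (fun h => by
      refine ContinuousLinearMap.opNorm_le_bound _ (by positivity) fun f => ?_
      calc ‖⟪inclPlus A f, h⟫_ℂ‖ ≤ ‖inclPlus A f‖ * ‖h‖ := norm_inner_le_norm _ _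
        _ ≤ (‖inclPlus A‖ * ‖f‖) * ‖h‖ := by gcongr; exact (inclPlus A).le_opNorm f
        _ = ‖inclPlus A‖ * ‖h‖ * ‖f‖ := by ring)

theorem inclMinus_apply (A : H →ₗ.[ℂ] H) (h : H) (f : HPlus A) :
    inclMinus A h f = ⟪inclPlus A f, h⟫_ℂ := rfl

variable {A : H →ₗ.[ℂ] H}

/-- The adjoint of an operator in `[H₊, H₋]`, again an operator in `[H₊, H₋]`. -/
def rigAdjoint (B : HPlus A →L[ℂ] HMinus A) : HPlus A →L[ℂ] HMinus A :=
  (ContinuousLinearMap.compSL (HPlus A) ℂ ℂ (RingHom.id ℂ) (starRingEnd ℂ)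
    ((starL ℂ : ℂ ≃L⋆[ℂ] ℂ) : ℂ →L⋆[ℂ] ℂ)).comp B.flip

theorem rigAdjoint_apply (B : HPlus A →L[ℂ] HMinus A) (f g : HPlus A) :
    rigAdjoint B f g = conj (B g f) := rfl

/-- The real part `(B + B*) / 2` of an operator in `[H₊, H₋]`. -/
def rigReal (B : HPlus A →L[ℂ] HMinus A) : HPlus A →L[ℂ] HMinus A :=
  (1 / 2 : ℂ) • (B + rigAdjoint B)

/-- The operator `S` in `H` is contained in the operator `B ∈ [H₊, H₋]`: `dom S ⊆ H₊` and `B`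
coincides with `S` on `dom S`. -/
def RigExtends (S : H →ₗ.[ℂ] H) (B : HPlus A →L[ℂ] HMinus A) : Prop :=
  ∀ x : S.domain, ∃ f : HPlus A, inclPlus A f = x ∧ B f = inclMinus A (S x)

section Complete

variable [CompleteSpace H]

/-- `c` is a regular point of the operator `T`: `T - c` has an inverse that is defined on all of `H`
and bounded. -/
def IsRegularPoint (T : H →ₗ.[ℂ] H) (c : ℂ) : Prop :=
  ∃ R : H →L[ℂ] H, ∀ x h : H, R h = x ↔ ∃ hx : x ∈ T.domain, T ⟨x, hx⟩ - c • x = h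

/-- The class `Ω_A`: closed densely defined operators `T` with `A = T ∩ T*` for which `-i` is a
regular point. -/
structure MemOmega (A T : H →ₗ.[ℂ] H) : Prop where
  closed : T.IsClosed
  dense : Dense (T.domain : Set H)
  inter : A.graph = T.graph ⊓ T.adjoint.graph
  regular : IsRegularPoint T (-Complex.I)

/-- `B` is a `(*)`-extension of `T`. -/
structure IsStarExtension (T : H →ₗ.[ℂ] H) (B : HPlus A →L[ℂ] HMinus A) : Prop where
  ext : RigExtends T B
  ext_adjoint : RigExtends T.adjoint (rigAdjoint B)

/-- `B` is a self-adjoint bi-extension of `A`: a bi-extension with `B = B*` for which the operator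
`{(x, B x) : x ∈ H₊, B x ∈ H}` is a self-adjoint extension of `A` in `H`. -/
structure IsSelfAdjointBiExtension (A : H →ₗ.[ℂ] H) (B : HPlus A →L[ℂ] HMinus A) : Prop where
  ext : RigExtends A B
  ext_adjoint : RigExtends A (rigAdjoint B)
  selfAdjoint : rigAdjoint B = B
  restriction : ∃ S : H →ₗ.[ℂ] H, Dense (S.domain : Set H) ∧ S.adjoint = S ∧ A ≤ S ∧
    ∀ x h : H, (x, h) ∈ S.graph ↔ ∃ f : HPlus A, inclPlus A f = x ∧ B f = inclMinus A h

/-- `B` is a correct `(*)`-extension of `T` (with respect to `A`). -/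
structure IsCorrectStarExtension (A T : H →ₗ.[ℂ] H) (B : HPlus A →L[ℂ] HMinus A) : Prop where
  starExtension : IsStarExtension T B
  correct : IsSelfAdjointBiExtension A (rigReal B)

end Complete

/-- `F` is an orthogonal projection in `H` and (its restriction is) an orthogonal projection
in `H₊`. -/
structure IsRiggedProjection (A : H →ₗ.[ℂ] H) (F : H →L[ℂ] H) : Prop where
  idem : ∀ x, F (F x) = F x
  symm : ∀ x y, ⟪F x, y⟫_ℂ = ⟪x, F y⟫_ℂ
  plus : ∃ G : HPlus A →L[ℂ] HPlus A, (∀ f, inclPlus A (G f) = F (inclPlus A f)) ∧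
    (∀ f, G (G f) = G f) ∧ ∀ f g, ⟪G f, g⟫_ℂ = ⟪f, G g⟫_ℂ

/-- The operator `B - z F` from `H₊` to `H₋`. -/
def pencil (B : HPlus A →L[ℂ] HMinus A) (F : H →L[ℂ] H) (z : ℂ) : HPlus A →L[ℂ] HMinus A :=
  B - z • (inclMinus A).comp (F.comp (inclPlus A))

/-- A linear left inverse of `B - z F`. If `B - z F` is injective, this is `(B - z F)⁻¹` on the
range of `B - z F`. -/
def pencilInv (B : HPlus A →L[ℂ] HMinus A) (F : H →L[ℂ] H) (z : ℂ) : HMinus A →ₗ[ℂ] HPlus A :=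
  LinearMap.leftInverse (pencil B F z : HPlus A →ₗ[ℂ] HMinus A)

theorem pencilInv_pencil (B : HPlus A →L[ℂ] HMinus A) (F : H →L[ℂ] H) (z : ℂ)
    (h : Function.Injective (pencil B F z)) (f : HPlus A) :
    pencilInv B F z (pencil B F z f) = f :=
  LinearMap.leftInverse_apply_of_inj (f := (pencil B F z : HPlus A →ₗ[ℂ] HMinus A))
    (LinearMap.ker_eq_bot.2 h) f

variable {E : Type u} [NormedAddCommGroup E] [InnerProductSpace ℂ E]

/-- The set `ρ(B, F, K)` of all `z` such that `(B - z F)⁻¹` exists on (the linear span of)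
`H ∪ ran K` and is `(-,·)`-continuous there, i.e. continuous from the norm of `H₋` to the norm
of `H`. -/
def rho (B : HPlus A →L[ℂ] HMinus A) (F : H →L[ℂ] H) (K : E →L[ℂ] HMinus A) : Set ℂ :=
  {z | Function.Injective (pencil B F z) ∧
    (∀ h : H, ∀ e : E, ∃ f : HPlus A, pencil B F z f = inclMinus A h + K e) ∧
    ∃ C : ℝ, ∀ (f : HPlus A) (h : H) (e : E), pencil B F z f = inclMinus A h + K e →
      ‖inclPlus A f‖ ≤ C * ‖pencil B F z f‖}

/-- The adjoint `K* ∈ [H₊, E]` of `K ∈ [E, H₋]`. -/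
def chanAdjoint [CompleteSpace E] (K : E →L[ℂ] HMinus A) : HPlus A →L[ℂ] E :=
  (((InnerProductSpace.toDual ℂ E).symm.toContinuousLinearEquiv :
    (E →L[ℂ] ℂ) ≃L⋆[ℂ] E) : (E →L[ℂ] ℂ) →L⋆[ℂ] E).comp K.flip

theorem chanAdjoint_inner [CompleteSpace E] (K : E →L[ℂ] HMinus A) (f : HPlus A) (e : E) :
    ⟪chanAdjoint K f, e⟫_ℂ = K e f :=
  InnerProductSpace.toDual_symm_apply

/-- The operator `K* (B - z F)⁻¹ K` in `E`. -/
def compressedResolvent [CompleteSpace E] [FiniteDimensional ℂ E] (B : HPlus A →L[ℂ] HMinus A)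
    (F : H →L[ℂ] H) (K : E →L[ℂ] HMinus A) (z : ℂ) : E →L[ℂ] E :=
  LinearMap.toContinuousLinearMap
    ((chanAdjoint K : HPlus A →ₗ[ℂ] E) ∘ₗ pencilInv B F z ∘ₗ (K : E →ₗ[ℂ] HMinus A))

end Rigged

/-! ### Impedance systems and `F₊`-systems -/

section Systems

variable {E H : Type u} [NormedAddCommGroup E] [InnerProductSpace ℂ E] [CompleteSpace E]
  [NormedAddCommGroup H] [InnerProductSpace ℂ H] [CompleteSpace H]

/-- The data `(D, F₊, K)` in the rigged Hilbert space of `A` form a `Δ₊`-system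
(impedance system). -/
structure IsDeltaSystem (A : H →ₗ.[ℂ] H) (D : HPlus A →L[ℂ] HMinus A) (F : H →L[ℂ] H)
    (K : E →L[ℂ] HMinus A) : Prop where
  closedHermitian : IsClosedHermitian A
  biExtension : IsSelfAdjointBiExtension A D
  injective : Function.Injective K
  projection : IsRiggedProjection A F
  isOpen_rho : IsOpen (rho D F K)

/-- The data `(B, F₊, K, J)` in the rigged Hilbert space of `A` form an `F₊`-system
(`F₊`-colligation); `B` is the main operator. -/
structure IsFSystem (A : H →ₗ.[ℂ] H) (B : HPlus A →L[ℂ] HMinus A) (F : H →L[ℂ] H)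
    (K : E →L[ℂ] HMinus A) (J : E →L[ℂ] E) : Prop where
  closedHermitian : IsClosedHermitian A
  correct : ∃ T : H →ₗ.[ℂ] H, MemOmega A T ∧ IsCorrectStarExtension A T B
  J_adjoint : ContinuousLinearMap.adjoint J = J
  J_involution : J * J = 1
  conservative : B - rigAdjoint B = (2 * Complex.I) • K.comp (J.comp (chanAdjoint K))
  injective : Function.Injective K
  projection : IsRiggedProjection A F
  isOpen_rho : IsOpen (rho B F K)
  isOpen_rho_real : IsOpen (rho (rigReal B) F K)
  isOpen_inter : IsOpen (rho B F K ∩ rho (rigReal B) F K)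
  conj_mem : ∀ z ∈ rho B F K, conj z ∈ rho (rigAdjoint B) F K
  conj_mem_real : ∀ z ∈ rho (rigReal B) F K, conj z ∈ rho (rigReal B) F K

/-- A scattering `F₊`-system: the case `J = I`. -/
def IsScatteringFSystem (A : H →ₗ.[ℂ] H) (B : HPlus A →L[ℂ] HMinus A) (F : H →L[ℂ] H)
    (K : E →L[ℂ] HMinus A) : Prop :=
  IsFSystem A B F K 1

variable [FiniteDimensional ℂ E]

/-- The transfer function `W(z) = I - 2 i K* (B - z F₊)⁻¹ K J`, meant for `z ∈ ρ(B, F₊, K)`. -/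
def transferFunction {A : H →ₗ.[ℂ] H} (B : HPlus A →L[ℂ] HMinus A) (F : H →L[ℂ] H)
    (K : E →L[ℂ] HMinus A) (J : E →L[ℂ] E) (z : ℂ) : E →L[ℂ] E :=
  1 - (2 * Complex.I) • (compressedResolvent B F K z * J)

end Systems

end

end FPlusRealization

namespace FPlusRealization

noncomputable section

/-! ### Operators given by their graphs -/

section Graphs

variable {H : Type u} [NormedAddCommGroup H] [InnerProductSpace ℂ H]

/-! `V` is realized as the Weyl function of a boundary triplet. Take a self-adjoint operator S in H
(the relation `op`) and formal channel vectors (Sβ + α)e with βe outside dom S for e ≠ 0. Let A be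
the restriction of S to the kernel of x ↦ β*Sx + α*x. Since E is finite-dimensional, A is densely
defined, and every f in dom A* is uniquely x + βe with x in dom S and A*f = Sx − αe
(`mem_plusSpace`). Put Γ₀f = e, and let Γ₁f be the channel functional with a regularizing constant
term. Green's identity (`green`) holds and (Γ₀, Γ₁) is onto E × E (`exists_boundary`). The channel
operator is defined by K* = Γ₁; the impedance operator is A* + KΓ₀, the main operator is A* + K(Γ₀ +
iΓ₁), and T is A* on ker(Γ₀ + iΓ₁).

Since H and ran K meet only in 0 inside H₋ (`source_injective`), the equation (B − zF)f = h + Ke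
splits into an equation in H and a boundary condition in E (`mem_rho_rig`). For the impedance
operator with h = 0 it reads A*f = zFf, Γ₀f = e, so the compressed resolvent is Γ₀f ↦ Γ₁f. If X is
the compressed resolvent of the main operator, then (1 + iV)(1 − iX) = 1, which gives the transfer
function formula. Invertibility of 1 + iV(z), automatic below the real axis, puts z into the
resolvent set of the main operator.

It remains to choose S, on L²(θ; E) ⊕ G ⊕ G with G = L²((0,1]; E). On the first summand S is
multiplication by t; the measure dΣ/(1+t²) has a matrix density with respect to θ, and E is embedded
through the square root of that density (`exists_embedding`). This block yields the integral and Q.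
On G ⊕ G, S is off-diagonal with entries W⁻¹, and F annihilates the last summand, so this block
contributes exactly zγ*γ = zL. Here γe is the constant function √L e; nonzero constants are not in
ran W, and invertibility of L then makes β singular. -/

theorem mem_toLinearPMap_domain {g : Submodule ℂ (H × H)} {x : H} :
    x ∈ g.toLinearPMap.domain ↔ ∃ v, (x, v) ∈ g := by
  rw [Submodule.toLinearPMap_domain]
  simp

/-- `hadj` says that `g'` is the adjoint relation of `g`; density of the domain makes it
single-valued. -/
theorem toLinearPMap_adjoint_eq [CompleteSpace H] {g g' : Submodule ℂ (H × H)}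
    (hg : ∀ w, ((0 : H), w) ∈ g → w = 0) (hd : Dense {x : H | ∃ v, (x, v) ∈ g})
    (hadj : ∀ y w, (y, w) ∈ g' ↔ ∀ x v, (x, v) ∈ g → ⟪v, y⟫_ℂ = ⟪x, w⟫_ℂ) :
    g.toLinearPMap.adjoint = g'.toLinearPMap := by
  have hs : ∀ x : H × H, x ∈ g → x.fst = 0 → x.snd = 0 := by
    rintro ⟨x, v⟩ h rfl
    exact hg v h
  have hd' : Dense (g.toLinearPMap.domain : Set H) := by
    convert hd using 1
    ext x
    exact mem_toLinearPMap_domain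
  have hs' : ∀ x : H × H, x ∈ g' → x.fst = 0 → x.snd = 0 := by
    rintro ⟨y, w⟩ h h0
    dsimp only at h0 ⊢
    subst h0
    refine hd.eq_zero_of_inner_right (𝕜 := ℂ) ?_
    rintro x ⟨v, hv⟩
    rw [← (hadj _ _).1 h x v hv, inner_zero_right]
  refine LinearPMap.eq_of_eq_graph ?_
  rw [LinearPMap.adjoint_graph_eq_graph_adjoint hd', Submodule.toLinearPMap_graph_eq _ hs,
    Submodule.toLinearPMap_graph_eq _ hs']
  ext ⟨y, w⟩
  rw [Submodule.mem_adjoint_iff, hadj]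
  simp only [sub_eq_zero]

end Graphs

/-! ### A self-adjoint operator with a singular channel -/

/-- A self-adjoint operator in `H`, given by its graph, with a channel space `E`. The channel
functional is `s ↦ β* (S s) + α* s`, and `β e` never lies in the domain of the operator. The
projection `F` is intertwined by the operator with a self-adjoint operator `F'`. -/
structure SingularChannel (E H : Type u) [NormedAddCommGroup E] [InnerProductSpace ℂ E]
    [CompleteSpace E] [NormedAddCommGroup H] [InnerProductSpace ℂ H] [CompleteSpace H] where
  /-- the graph of the self-adjoint operator -/
  op : Submodule ℂ (H × H)
  op_single : ∀ w, ((0 : H), w) ∈ op → w = 0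
  mem_op_iff : ∀ y w, (y, w) ∈ op ↔ ∀ x v, (x, v) ∈ op → ⟪v, y⟫_ℂ = ⟪x, w⟫_ℂ
  /-- the part of the channel functional acting on the vector -/
  α : E →L[ℂ] H
  /-- the part of the channel functional acting on the image of the vector -/
  β : E →L[ℂ] H
  -- Density of dom A, uniqueness of the singular coefficient and surjectivity of the channel
  -- functional on `op` all rest on this condition.
  β_singular : ∀ e w, (β e, w) ∈ op → e = 0
  /-- the constant term in the regularized channel functional -/
  Q₀ : E →L[ℂ] E
  Q₀_symm : ∀ e e', ⟪Q₀ e, e'⟫_ℂ = ⟪e, Q₀ e'⟫_ℂ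
  /-- the projection in `H` -/
  F : H →L[ℂ] H
  /-- the self-adjoint operator intertwined with `F` -/
  F' : H →L[ℂ] H
  F_idem : ∀ x, F (F x) = F x
  F_symm : ∀ x y, ⟪F x, y⟫_ℂ = ⟪x, F y⟫_ℂ
  F'_symm : ∀ x y, ⟪F' x, y⟫_ℂ = ⟪x, F' y⟫_ℂ
  -- Together with the two fixed-point conditions that follow, this makes (F, F') preserve the graph
  -- of A*, so that F restricts to H₊.
  F_op : ∀ x v, (x, v) ∈ op → (F x, F' v) ∈ op
  F_β : ∀ e, F (β e) = β e
  F'_α : ∀ e, F' (α e) = α e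
  pencil_injective : ∀ z : ℂ, z.im ≠ 0 → ∀ x, (x, z • F x) ∈ op → x = 0
  pencil_surjective : ∀ z : ℂ, z.im ≠ 0 → ∀ h, ∃ x, (x, h + z • F x) ∈ op

namespace SingularChannel

variable {E H : Type u} [NormedAddCommGroup E] [InnerProductSpace ℂ E] [CompleteSpace E]
  [NormedAddCommGroup H] [InnerProductSpace ℂ H] [CompleteSpace H] (M : SingularChannel E H)

/-! ### The Hermitian restriction A and its adjoint -/

theorem op_symm {x v y w : H} (hx : (x, v) ∈ M.op) (hy : (y, w) ∈ M.op) :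
    ⟪v, y⟫_ℂ = ⟪x, w⟫_ℂ := (M.mem_op_iff y w).1 hy x v hx

theorem isClosed_op : IsClosed (M.op : Set (H × H)) := by
  have : (M.op : Set (H × H))
      = ⋂ p : M.op, {q | ⟪(p : H × H).2, q.1⟫_ℂ = ⟪(p : H × H).1, q.2⟫_ℂ} := by
    ext ⟨y, w⟩
    rw [Set.mem_iInter]
    exact (M.mem_op_iff y w).trans ⟨fun h p => h _ _ p.2, fun h x v hx => h ⟨(x, v), hx⟩⟩
  rw [this]
  exact isClosed_iInter fun p => isClosed_eq (by fun_prop) (by fun_prop)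

/-- The channel functional. -/
def chan : H × H →L[ℂ] E :=
  (ContinuousLinearMap.adjoint M.β).comp (ContinuousLinearMap.snd ℂ H H)
    + (ContinuousLinearMap.adjoint M.α).comp (ContinuousLinearMap.fst ℂ H H)

theorem chan_apply (x v : H) :
    M.chan (x, v) = ContinuousLinearMap.adjoint M.β v + ContinuousLinearMap.adjoint M.α x := rfl

theorem inner_chan (e : E) (x v : H) :
    ⟪e, M.chan (x, v)⟫_ℂ = ⟪M.β e, v⟫_ℂ + ⟪M.α e, x⟫_ℂ := by
  rw [chan_apply, inner_add_right, ContinuousLinearMap.adjoint_inner_right,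
    ContinuousLinearMap.adjoint_inner_right]

theorem inner_chan_left (e : E) (x v : H) :
    ⟪M.chan (x, v), e⟫_ℂ = ⟪v, M.β e⟫_ℂ + ⟪x, M.α e⟫_ℂ := by
  rw [chan_apply, inner_add_left, ContinuousLinearMap.adjoint_inner_left,
    ContinuousLinearMap.adjoint_inner_left]

/-- The graph of the restriction of the operator to the kernel of the channel functional. -/
def hermGraph : Submodule ℂ (H × H) := M.op ⊓ LinearMap.ker (M.chan : H × H →ₗ[ℂ] E)

theorem mem_hermGraph {p : H × H} : p ∈ M.hermGraph ↔ p ∈ M.op ∧ M.chan p = 0 := Iff.rfl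

/-- The Hermitian operator: the restriction to the kernel of the channel functional. -/
def herm : H →ₗ.[ℂ] H := M.hermGraph.toLinearPMap

theorem herm_graph : M.herm.graph = M.hermGraph := by
  refine Submodule.toLinearPMap_graph_eq _ ?_
  rintro ⟨x, v⟩ h rfl
  exact M.op_single v h.1

theorem herm_mem (x : M.herm.domain) : ((x : H), M.herm x) ∈ M.hermGraph := by
  rw [← herm_graph]
  exact LinearPMap.mem_graph _ x

theorem isClosedHermitian_herm : IsClosedHermitian M.herm where
  closed := by
    unfold LinearPMap.IsClosed
    rw [herm_graph]
    exact M.isClosed_op.inter (isClosed_eq M.chan.continuous continuous_const)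
  hermitian := fun x y => M.op_symm (M.herm_mem x).1 (M.herm_mem y).1

/-- The functional (x, v) ↦ ⟪y, v⟫ − ⟪w, x⟫ on `op` vanishes on the kernel of the channel
functional, hence factors through it; as E is finite-dimensional, the factor is ⟪e, ·⟫ for some e.
Moving this term to the other side places the corrected pair in the adjoint relation of `op`, which
is `op`. -/
theorem exists_of_forall_herm [FiniteDimensional ℂ E] {y w : H}
    (h : ∀ x v, (x, v) ∈ M.hermGraph → ⟪v, y⟫_ℂ = ⟪x, w⟫_ℂ) :
    ∃ e, (y - M.β e, w + M.α e) ∈ M.op := by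
  let k : M.op →ₗ[ℂ] E := (M.chan : H × H →ₗ[ℂ] E).comp M.op.subtype
  let φ : M.op →ₗ[ℂ] ℂ :=
    ((innerₛₗ ℂ y).comp (LinearMap.snd ℂ H H) - (innerₛₗ ℂ w).comp (LinearMap.fst ℂ H H)).comp
      M.op.subtype
  have hφ : φ ∈ (LinearMap.ker k).dualAnnihilator := by
    rw [Submodule.mem_dualAnnihilator]
    rintro ⟨⟨x, v⟩, hx⟩ hk
    have := h x v ⟨hx, hk⟩
    change ⟪y, v⟫_ℂ - ⟪w, x⟫_ℂ = 0
    rw [← inner_conj_symm, this, inner_conj_symm, sub_self]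
  rw [← LinearMap.range_dualMap_eq_dualAnnihilator_ker] at hφ
  obtain ⟨ψ, hψ⟩ := hφ
  let e := (InnerProductSpace.toDual ℂ E).symm (LinearMap.toContinuousLinearMap ψ)
  have he : ∀ a, ⟪e, a⟫_ℂ = ψ a := fun a => InnerProductSpace.toDual_symm_apply
  refine ⟨e, (M.mem_op_iff _ _).2 fun x v hx => ?_⟩
  have h1 : ψ (M.chan (x, v)) = ⟪y, v⟫_ℂ - ⟪w, x⟫_ℂ :=
    LinearMap.congr_fun hψ ⟨(x, v), hx⟩
  rw [← he, inner_chan] at h1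
  have h2 := congrArg conj h1
  simp only [map_add, map_sub, inner_conj_symm] at h2
  rw [inner_sub_right, inner_add_right]
  linear_combination -h2

/-- If y is orthogonal to dom A, then (−βe, y + αe) lies in `op` for some e. Singularity of β gives
e = 0, and then y is the image of 0. -/
theorem dense_herm [FiniteDimensional ℂ E] : Dense (M.herm.domain : Set H) := by
  rw [Submodule.dense_iff_topologicalClosure_eq_top, Submodule.topologicalClosure_eq_top_iff,
    Submodule.eq_bot_iff]
  intro y hy
  rw [Submodule.mem_orthogonal] at hy
  obtain ⟨e, he⟩ := M.exists_of_forall_herm (y := 0) (w := y) fun x v hx => by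
    rw [inner_zero_right, hy x (mem_toLinearPMap_domain.2 ⟨v, hx⟩)]
  have h0 : e = 0 := by
    have := M.op.neg_mem he
    rw [Prod.neg_mk, zero_sub, neg_neg] at this
    exact M.β_singular _ _ this
  rw [h0] at he
  exact M.op_single y (by simpa using he)

/-- This identifies A*. As A is dense, the condition on the closure of its domain is void; one
direction is the factorization above, the other is the symmetry of S with the vanishing of the
channel functional on A. -/
theorem mem_plusSpace [FiniteDimensional ℂ E] {p : WithLp 2 (H × H)} :
    p ∈ plusSpace M.herm ↔ ∃ e, (p.fst - M.β e, p.snd + M.α e) ∈ M.op := by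
  constructor
  · rintro ⟨-, hp⟩
    refine M.exists_of_forall_herm fun x v hx => ?_
    rw [← herm_graph] at hx
    obtain ⟨z, rfl, rfl⟩ := (LinearPMap.mem_graph_iff _).1 hx
    exact hp z
  · rintro ⟨e, he⟩
    refine ⟨?_, fun x => ?_⟩
    · rw [Submodule.dense_iff_topologicalClosure_eq_top.1 M.dense_herm]
      trivial
    · obtain ⟨h1, h2⟩ := M.mem_hermGraph.1 (M.herm_mem x)
      have h3 := M.op_symm h1 he
      have h4 := M.inner_chan_left e x (M.herm x)
      rw [h2, inner_zero_left] at h4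
      rw [inner_sub_right, inner_add_right] at h3
      linear_combination h3 - h4

theorem isClosed_plusSpace : IsClosed (plusSpace M.herm : Set (WithLp 2 (H × H))) := by
  have : (plusSpace M.herm : Set (WithLp 2 (H × H)))
      = {p | p.snd ∈ M.herm.domain.topologicalClosure} ∩
        ⋂ x : M.herm.domain, {p | ⟪M.herm x, p.fst⟫_ℂ = ⟪(x : H), p.snd⟫_ℂ} := by
    ext p
    simp only [Set.mem_inter_iff, Set.mem_iInter]
    rfl
  rw [this]
  refine IsClosed.inter ?_ (isClosed_iInter fun x => isClosed_eq ?_ ?_)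
  · exact M.herm.domain.isClosed_topologicalClosure.preimage
      (WithLp.sndL 2 ℂ H H).continuous
  · exact continuous_const.inner (WithLp.fstL 2 ℂ H H).continuous
  · exact continuous_const.inner (WithLp.sndL 2 ℂ H H).continuous

/-- The operator `A*` on `H₊`. -/
def maxOp : HPlus M.herm →L[ℂ] H := (WithLp.sndL 2 ℂ H H).comp (plusSpace M.herm).subtypeL

/-- The inclusion of `H₊`. -/
abbrev incl : HPlus M.herm →L[ℂ] H := inclPlus M.herm

/-! ### Boundary maps and Green's identity -/

theorem singular_unique {f : HPlus M.herm} {e e' : E}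
    (h : (M.incl f - M.β e, M.maxOp f + M.α e) ∈ M.op)
    (h' : (M.incl f - M.β e', M.maxOp f + M.α e') ∈ M.op) : e = e' := by
  have := M.op.sub_mem h' h
  rw [Prod.mk_sub_mk, sub_sub_sub_cancel_left, ← map_sub] at this
  exact sub_eq_zero.1 (M.β_singular _ _ this)

theorem norm_plus_le (f : HPlus M.herm) : ‖f‖ ≤ ‖M.incl f‖ + ‖M.maxOp f‖ := by
  have e : ‖f‖ ^ 2 = ‖M.incl f‖ ^ 2 + ‖M.maxOp f‖ ^ 2 := WithLp.prod_norm_sq_eq_of_L2 f.1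
  refine abs_le_of_sq_le_sq' ?_ (by positivity) |>.2
  nlinarith [norm_nonneg (M.incl f), norm_nonneg (M.maxOp f)]

variable [FiniteDimensional ℂ E]

instance : CompleteSpace (HPlus M.herm) := M.isClosed_plusSpace.completeSpace_coe

theorem exists_singular (f : HPlus M.herm) :
    ∃ e, (M.incl f - M.β e, M.maxOp f + M.α e) ∈ M.op := M.mem_plusSpace.1 f.2

/-- The coefficient of the singular part of an element of `H₊`, as a linear map. -/
def singularₗ : HPlus M.herm →ₗ[ℂ] E where
  toFun f := (M.exists_singular f).choose
  map_add' f g := by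
    refine M.singular_unique (M.exists_singular _).choose_spec ?_
    convert M.op.add_mem (M.exists_singular f).choose_spec (M.exists_singular g).choose_spec using 1
    rw [Prod.mk_add_mk]
    simp only [map_add]
    congr 1 <;> abel
  map_smul' c f := by
    refine M.singular_unique (M.exists_singular _).choose_spec ?_
    convert M.op.smul_mem c (M.exists_singular f).choose_spec using 1
    rw [Prod.smul_mk]
    simp only [map_smul, RingHom.id_apply, smul_sub, smul_add]

/-- The first boundary map: the coefficient of the singular part of an element of `H₊`. -/
def singular : HPlus M.herm →L[ℂ] E where
  toLinearMap := M.singularₗ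
  cont := by
    -- Closed graph theorem: the graph is the preimage of the closed relation `op` under a
    -- continuous map.
    refine M.singularₗ.continuous_of_isClosed_graph ?_
    have : (M.singularₗ.graph : Set (HPlus M.herm × E))
        = (fun p : HPlus M.herm × E => (M.incl p.1 - M.β p.2, M.maxOp p.1 + M.α p.2)) ⁻¹' M.op := by
      ext ⟨f, e⟩
      constructor
      · intro h
        have h' : e = M.singularₗ f := h
        subst h'
        exact (M.exists_singular f).choose_spec
      · intro h
        exact M.singular_unique h (M.exists_singular f).choose_spec
    rw [this]
    exact M.isClosed_op.preimage (by fun_prop)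

theorem singular_spec (f : HPlus M.herm) :
    (M.incl f - M.β (M.singular f), M.maxOp f + M.α (M.singular f)) ∈ M.op :=
  (M.exists_singular f).choose_spec

theorem singular_eq {f : HPlus M.herm} {e : E}
    (h : (M.incl f - M.β e, M.maxOp f + M.α e) ∈ M.op) : M.singular f = e :=
  M.singular_unique (M.singular_spec f) h

/-- The second boundary map: the regularized channel functional. -/
def regular : HPlus M.herm →L[ℂ] E :=
  (ContinuousLinearMap.adjoint M.β).comp (M.maxOp + M.α.comp M.singular)
    + (ContinuousLinearMap.adjoint M.α).comp M.incl + M.Q₀.comp M.singular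

theorem regular_apply (f : HPlus M.herm) :
    M.regular f = ContinuousLinearMap.adjoint M.β (M.maxOp f + M.α (M.singular f))
      + ContinuousLinearMap.adjoint M.α (M.incl f) + M.Q₀ (M.singular f) := rfl

/-- The element of `H₊` with given regular part `x` and singular coefficient `e`. -/
def toPlus {x v : H} (h : (x, v) ∈ M.op) (e : E) : HPlus M.herm :=
  ⟨WithLp.toLp 2 (x + M.β e, v - M.α e), M.mem_plusSpace.2 ⟨e, by simpa using h⟩⟩

theorem incl_toPlus {x v : H} (h : (x, v) ∈ M.op) (e : E) :
    M.incl (M.toPlus h e) = x + M.β e := rfl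

theorem maxOp_toPlus {x v : H} (h : (x, v) ∈ M.op) (e : E) :
    M.maxOp (M.toPlus h e) = v - M.α e := rfl

theorem singular_toPlus {x v : H} (h : (x, v) ∈ M.op) (e : E) :
    M.singular (M.toPlus h e) = e :=
  M.singular_eq (by rw [incl_toPlus, maxOp_toPlus]; simpa using h)

theorem regular_toPlus {x v : H} (h : (x, v) ∈ M.op) (e : E) :
    M.regular (M.toPlus h e) = M.chan (x, v)
      + ContinuousLinearMap.adjoint M.α (M.β e) + M.Q₀ e := by
  rw [regular_apply, singular_toPlus, incl_toPlus, maxOp_toPlus, chan_apply]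
  simp only [sub_add_cancel, map_add]
  abel

theorem maxOp_unique {f g : HPlus M.herm} (h : M.incl f = M.incl g) : f = g := by
  have h1 := M.op.sub_mem (M.singular_spec f) (M.singular_spec g)
  rw [Prod.mk_sub_mk, h, sub_sub_sub_cancel_left, ← map_sub] at h1
  have h2 := sub_eq_zero.1 (M.β_singular _ _ h1)
  rw [h2, sub_self, map_zero, add_sub_add_right_eq_sub] at h1
  apply Subtype.ext
  apply WithLp.ofLp_injective
  exact Prod.ext h (sub_eq_zero.1 (M.op_single _ h1))

theorem incl_injective : Function.Injective M.incl := fun _ _ h => M.maxOp_unique h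

/-- This is the symmetry of S applied to the regular parts. The cross terms with α and β are those
built into Γ₁, and the `Q₀` terms cancel because `Q₀` is symmetric. -/
theorem green (f g : HPlus M.herm) :
    ⟪M.maxOp f, M.incl g⟫_ℂ + ⟪M.singular f, M.regular g⟫_ℂ
      = ⟪M.incl f, M.maxOp g⟫_ℂ + ⟪M.regular f, M.singular g⟫_ℂ := by
  have h := M.op_symm (M.singular_spec f) (M.singular_spec g)
  rw [regular_apply, regular_apply]
  simp only [inner_sub_left, inner_sub_right, inner_add_left, inner_add_right, map_add,
    ContinuousLinearMap.adjoint_inner_left, ContinuousLinearMap.adjoint_inner_right,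
    M.Q₀_symm] at h ⊢
  linear_combination h

/-- If a is orthogonal to all channel values, then (βa, −αa) belongs to the adjoint relation of
`op`, that is to `op`, so a = 0. -/
theorem exists_chan_eq (e : E) : ∃ x v, (x, v) ∈ M.op ∧ M.chan (x, v) = e := by
  have : (M.op.map (M.chan : H × H →ₗ[ℂ] E)) = ⊤ := by
    rw [← Submodule.orthogonal_eq_bot_iff, Submodule.eq_bot_iff]
    intro a ha
    rw [Submodule.mem_orthogonal] at ha
    refine M.β_singular a (-M.α a) ((M.mem_op_iff _ _).2 fun x v hx => ?_)
    have h1 := ha _ ⟨(x, v), hx, rfl⟩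
    have h2 := M.inner_chan_left a x v
    rw [h2.symm.trans h1 |> fun h => (by linear_combination h :
      ⟪v, M.β a⟫_ℂ = -⟪x, M.α a⟫_ℂ), inner_neg_right]
  have h : e ∈ (M.op.map (M.chan : H × H →ₗ[ℂ] E)) := by rw [this]; trivial
  obtain ⟨⟨x, v⟩, hx, h'⟩ := h
  exact ⟨x, v, hx, h'⟩

theorem exists_boundary (a b : E) : ∃ f, M.singular f = a ∧ M.regular f = b := by
  obtain ⟨x, v, hx, h⟩ := M.exists_chan_eq
    (b - (ContinuousLinearMap.adjoint M.α (M.β a) + M.Q₀ a))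
  refine ⟨M.toPlus hx a, M.singular_toPlus hx a, ?_⟩
  rw [regular_toPlus, h]
  abel

/-! ### The channel operator and the operators in the rigged space -/

/-- The channel operator `K`, with `(K e) f = (Γ₁ f, e)`. -/
def chanMinus : E →L[ℂ] HMinus M.herm :=
  LinearMap.mkContinuous
    { toFun := fun e => (((innerSL ℂ : E →L⋆[ℂ] E →L[ℂ] ℂ).flip e).comp M.regular :
        HPlus M.herm →L⋆[ℂ] ℂ)
      map_add' := fun a b => by ext f; simp
      map_smul' := fun c a => by ext f; simp }
    ‖M.regular‖ (fun e => by
      refine ContinuousLinearMap.opNorm_le_bound _ (by positivity) fun f => ?_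
      calc ‖⟪M.regular f, e⟫_ℂ‖ ≤ ‖M.regular f‖ * ‖e‖ := norm_inner_le_norm _ _
        _ ≤ (‖M.regular‖ * ‖f‖) * ‖e‖ := by gcongr; exact M.regular.le_opNorm f
        _ = ‖M.regular‖ * ‖e‖ * ‖f‖ := by ring)

theorem chanMinus_apply (e : E) (f : HPlus M.herm) : M.chanMinus e f = ⟪M.regular f, e⟫_ℂ := rfl

theorem chanAdjoint_chanMinus : chanAdjoint M.chanMinus = M.regular := by
  refine ContinuousLinearMap.ext fun f => ext_inner_right ℂ fun e => ?_
  rw [chanAdjoint_inner, chanMinus_apply]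

/-- The map `(h, e) ↦ h + K e` into `H₋`. -/
def source : H × E →L[ℂ] HMinus M.herm := (inclMinus M.herm).coprod M.chanMinus

theorem source_apply (h : H) (e : E) : M.source (h, e) = inclMinus M.herm h + M.chanMinus e :=
  rfl

theorem source_apply_apply (h : H) (e : E) (f : HPlus M.herm) :
    M.source (h, e) f = ⟪M.incl f, h⟫_ℂ + ⟪M.regular f, e⟫_ℂ := rfl

/-- Testing on dom A, where Γ₁ vanishes, gives h = 0 by density; surjectivity of Γ₁ then gives e =
0. Thus H + ran K is a direct sum in H₋. -/
theorem source_injective : Function.Injective M.source := by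
  rw [injective_iff_map_eq_zero]
  rintro ⟨h, e⟩ hz
  have hz' : ∀ f, ⟪M.incl f, h⟫_ℂ + ⟪M.regular f, e⟫_ℂ = 0 := fun f => by
    rw [← source_apply_apply, hz]; rfl
  have h1 : h = 0 := by
    refine M.dense_herm.eq_zero_of_inner_right (𝕜 := ℂ) fun x hx => ?_
    obtain ⟨v, hv, hv'⟩ := mem_toLinearPMap_domain.1 hx
    have := hz' (M.toPlus hv 0)
    rw [regular_toPlus, show M.chan (x, v) = 0 from hv', incl_toPlus] at this
    simpa using this
  obtain ⟨f, -, hf⟩ := M.exists_boundary 0 e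
  have h2 := hz' f
  rw [h1, hf, inner_zero_right, zero_add, inner_self_eq_zero] at h2
  rw [h1, h2]
  rfl

theorem chanMinus_injective : Function.Injective M.chanMinus := fun a b h => by
  have : M.source (0, a) = M.source (0, b) := by
    rw [source_apply, source_apply, h]
  exact congrArg Prod.snd (M.source_injective this)

/-- The operator `f ↦ ((A* + N) f, Γ₀ f + c Γ₁ f)`. -/
def bdry (c : ℂ) (N : H →L[ℂ] H) : HPlus M.herm →L[ℂ] H × E :=
  (M.maxOp + N.comp M.incl).prod (M.singular + c • M.regular)

theorem bdry_apply (c : ℂ) (N : H →L[ℂ] H) (f : HPlus M.herm) :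
    M.bdry c N f = (M.maxOp f + N (M.incl f), M.singular f + c • M.regular f) := rfl

/-- The operator `A* + N + K (Γ₀ + c Γ₁)` from `H₊` to `H₋`. -/
def rig (c : ℂ) (N : H →L[ℂ] H) : HPlus M.herm →L[ℂ] HMinus M.herm :=
  M.source.comp (M.bdry c N)

theorem rig_apply (c : ℂ) (N : H →L[ℂ] H) (f : HPlus M.herm) :
    M.rig c N f = M.source (M.bdry c N f) := rfl

theorem rig_apply_apply (c : ℂ) (N : H →L[ℂ] H) (f g : HPlus M.herm) :
    M.rig c N f g = ⟪M.incl g, M.maxOp f⟫_ℂ + ⟪M.incl g, N (M.incl f)⟫_ℂ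
      + ⟪M.regular g, M.singular f⟫_ℂ + c * ⟪M.regular g, M.regular f⟫_ℂ := by
  rw [rig_apply, bdry_apply, source_apply_apply, inner_add_right, inner_add_right,
    inner_smul_right]
  ring

/-- By Green's identity the form of A* + KΓ₀ is symmetric, so only c and N get conjugated. -/
theorem rig_conj (c : ℂ) (N : H →L[ℂ] H) (f g : HPlus M.herm) :
    conj (M.rig c N g f) = M.rig (conj c) (ContinuousLinearMap.adjoint N) f g := by
  rw [rig_apply_apply, rig_apply_apply]
  simp only [map_add, map_mul, inner_conj_symm, ContinuousLinearMap.adjoint_inner_right]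
  linear_combination M.green g f

theorem rigAdjoint_rig (c : ℂ) (N : H →L[ℂ] H) :
    rigAdjoint (M.rig c N) = M.rig (conj c) (ContinuousLinearMap.adjoint N) := by
  refine ContinuousLinearMap.ext fun f => ContinuousLinearMap.ext fun g => ?_
  rw [rigAdjoint_apply, rig_conj]

theorem pencil_rig (c : ℂ) (N F : H →L[ℂ] H) (z : ℂ) :
    pencil (M.rig c N) F z = M.rig c (N - z • F) := by
  refine ContinuousLinearMap.ext fun f => ?_
  rw [rig_apply, bdry_apply, source_apply, pencil]
  change M.rig c N f - z • inclMinus M.herm (F (M.incl f)) = _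
  rw [rig_apply, bdry_apply, source_apply, ← map_smul (inclMinus M.herm), add_sub_right_comm,
    ← map_sub (inclMinus M.herm), add_sub_assoc]
  rfl

/-- A weak solution of the adjoint boundary problem is a strong one. Testing on dom A puts y in dom
A*; the boundary terms left over in Green's identity then force the adjoint boundary condition,
because Γ₁ is onto on ker(Γ₀ + cΓ₁). -/
theorem exists_of_forall {c : ℂ} {N : H →L[ℂ] H} {y w : H}
    (h : ∀ f, M.singular f + c • M.regular f = 0 →
      ⟪M.maxOp f + N (M.incl f), y⟫_ℂ = ⟪M.incl f, w⟫_ℂ) :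
    ∃ g, M.incl g = y ∧ M.bdry (conj c) (ContinuousLinearMap.adjoint N) g = (w, 0) := by
  obtain ⟨e, he⟩ := M.exists_of_forall_herm (y := y) (w := w - ContinuousLinearMap.adjoint N y)
    fun x v hx => by
      have h1 := h (M.toPlus hx.1 0) (by
        rw [singular_toPlus, regular_toPlus, show M.chan (x, v) = 0 from hx.2]
        simp)
      rw [incl_toPlus, maxOp_toPlus] at h1
      simp only [map_zero, sub_zero, add_zero, inner_add_left] at h1
      rw [inner_sub_right, ContinuousLinearMap.adjoint_inner_right]
      linear_combination h1
  have hi : M.incl (M.toPlus he e) = y := by rw [incl_toPlus, sub_add_cancel]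
  have hm : M.maxOp (M.toPlus he e) = w - ContinuousLinearMap.adjoint N y := by
    rw [maxOp_toPlus, add_sub_cancel_right]
  set g := M.toPlus he e with hg
  refine ⟨g, hi, ?_⟩
  rw [bdry_apply, hi, hm, sub_add_cancel]
  congr 1
  have key : ∀ f, M.singular f + c • M.regular f = 0 →
      ⟪M.regular f, M.singular g + conj c • M.regular g⟫_ℂ = 0 := by
    intro f hf
    have h1 := h f hf
    have h2 := M.green f g
    rw [hi, hm] at h2
    have h3 : ⟪M.singular f, M.regular g⟫_ℂ = -(conj c * ⟪M.regular f, M.regular g⟫_ℂ) := by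
      rw [eq_neg_of_add_eq_zero_left hf, inner_neg_left, inner_smul_left]
    rw [inner_add_left] at h1
    rw [inner_sub_right, ContinuousLinearMap.adjoint_inner_right] at h2
    rw [inner_add_right, inner_smul_right]
    linear_combination h1 - h2 + h3
  -- With b the boundary value that should vanish, take Γ₁f = b and Γ₀f = −cb; the orthogonality
  -- relation `key` becomes ⟪b, b⟫ = 0.
  obtain ⟨f, hf, hf'⟩ := M.exists_boundary (-(c • (M.singular g + conj c • M.regular g)))
    (M.singular g + conj c • M.regular g)
  have := key f (by rw [hf, hf', neg_add_cancel])
  rw [hf', inner_self_eq_zero] at this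
  exact this

/-- The isomorphism given by a bijective `bdry c N`. -/
def bdryEquiv {c : ℂ} {N : H →L[ℂ] H} (h : Function.Bijective (M.bdry c N)) :
    HPlus M.herm ≃L[ℂ] H × E :=
  ContinuousLinearEquiv.ofBijective (M.bdry c N)
    (LinearMap.ker_eq_bot.2 h.1) (LinearMap.range_eq_top.2 h.2)

theorem bdryEquiv_apply {c : ℂ} {N : H →L[ℂ] H} (h : Function.Bijective (M.bdry c N))
    (f : HPlus M.herm) : M.bdryEquiv h f = M.bdry c N f := rfl

theorem bdry_bdryEquiv_symm {c : ℂ} {N : H →L[ℂ] H} (h : Function.Bijective (M.bdry c N))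
    (p : H × E) : M.bdry c N ((M.bdryEquiv h).symm p) = p :=
  (M.bdryEquiv h).apply_symm_apply p

/-- Surjectivity on `H × {0}` suffices. -/
theorem bdry_surjective {c : ℂ} {N : H →L[ℂ] H} (h : ∀ w, ∃ f, M.bdry c N f = (w, 0)) :
    Function.Surjective (M.bdry c N) := by
  rintro ⟨w, e⟩
  obtain ⟨f, hf, hf'⟩ := M.exists_boundary e 0
  obtain ⟨g, hg⟩ := h (w - (M.maxOp f + N (M.incl f)))
  refine ⟨g + f, ?_⟩
  rw [map_add, hg, bdry_apply, hf, hf', smul_zero, add_zero, Prod.mk_add_mk, sub_add_cancel,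
    zero_add]

/-- Injectivity: a solution g of the homogeneous adjoint problem is annihilated by every `rig c N
f`, and these exhaust H. Surjectivity: with R the H-part of the inverse, R*w is a weak solution of
the adjoint problem with right-hand side w. -/
theorem bijective_adjoint {c : ℂ} {N : H →L[ℂ] H} (h : Function.Bijective (M.bdry c N)) :
    Function.Bijective (M.bdry (conj c) (ContinuousLinearMap.adjoint N)) := by
  constructor
  · rw [injective_iff_map_eq_zero]
    intro g hg
    have h1 : ∀ f, M.rig c N f g = 0 := fun f => by
      have := M.rig_conj c N g f
      rw [rig_apply (c := conj c), hg, map_zero] at this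
      simpa using this
    refine M.incl_injective ?_
    rw [map_zero]
    refine ext_inner_right ℂ fun x => ?_
    obtain ⟨f, hf⟩ := h.2 (x, 0)
    have h2 := h1 f
    rw [rig_apply, hf, source_apply_apply, inner_zero_right, add_zero] at h2
    rw [h2, inner_zero_left]
  · refine M.bdry_surjective fun w => ?_
    let R : H →L[ℂ] H := M.incl.comp (((M.bdryEquiv h).symm : H × E →L[ℂ] HPlus M.herm).comp
      (ContinuousLinearMap.inl ℂ H E))
    obtain ⟨g, -, hg⟩ := M.exists_of_forall (c := c) (N := N)
      (y := ContinuousLinearMap.adjoint R w) (w := w) fun f hf => by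
        rw [ContinuousLinearMap.adjoint_inner_right]
        have h1 : (M.maxOp f + N (M.incl f), (0 : E)) = M.bdryEquiv h f := by
          rw [bdryEquiv_apply, bdry_apply, hf]
        have : R (M.maxOp f + N (M.incl f)) = M.incl f := by
          change M.incl ((M.bdryEquiv h).symm (M.maxOp f + N (M.incl f), (0 : E))) = _
          rw [h1, ContinuousLinearEquiv.symm_apply_apply]
        rw [this]
    exact ⟨g, hg⟩

/-- The inverse is bounded for the norm of H × E, but the norm of H₋ is weaker, so duality is used.
For x the vector of f, let Rx solve the adjoint problem with data (x, 0); pairing gives ‖x‖² ≤ ‖`rig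
c N f`‖ ‖R‖ ‖x‖. -/
theorem exists_bound {c : ℂ} {N : H →L[ℂ] H} (h : Function.Bijective (M.bdry c N)) :
    ∃ C : ℝ, ∀ f : HPlus M.herm, ‖M.incl f‖ ≤ C * ‖M.rig c N f‖ := by
  have h' := M.bijective_adjoint h
  let R : H →L[ℂ] HPlus M.herm := ((M.bdryEquiv h').symm : H × E →L[ℂ] HPlus M.herm).comp
      (ContinuousLinearMap.inl ℂ H E)
  have hR : ∀ x, M.bdry (conj c) (ContinuousLinearMap.adjoint N) (R x) = (x, 0) :=
    fun x => M.bdry_bdryEquiv_symm h' (x, 0)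
  refine ⟨‖R‖, fun f => ?_⟩
  set x := M.incl f with hx
  have h1 : M.rig c N f (R x) = ((‖x‖ ^ 2 : ℝ) : ℂ) := by
    have h2 := M.rig_conj c N (R x) f
    rw [rig_apply (c := conj c), hR, source_apply_apply, inner_zero_right, add_zero, ← hx,
      inner_self_eq_norm_sq_to_K] at h2
    rw [← Complex.conj_conj (M.rig c N f (R x)), h2]
    simp
  have h2 : ‖x‖ ^ 2 ≤ ‖M.rig c N f‖ * (‖R‖ * ‖x‖) := by
    calc ‖x‖ ^ 2 = ‖M.rig c N f (R x)‖ := by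
          rw [h1, Complex.norm_real]; simp
      _ ≤ ‖M.rig c N f‖ * ‖R x‖ := ContinuousLinearMap.le_opNorm _ _
      _ ≤ _ := by
          gcongr
          exact R.le_opNorm x
  by_cases h0 : ‖x‖ = 0
  · rw [h0]; positivity
  have h3 : 0 < ‖x‖ := lt_of_le_of_ne (norm_nonneg _) (Ne.symm h0)
  refine le_of_mul_le_mul_right ?_ h3
  nlinarith

/-- The pencil is `source ∘ bdry` with `source` injective and range H + ran K, so solvability there
is bijectivity of `bdry`; the continuity requirement then follows from `exists_bound`. -/
theorem mem_rho_rig {c : ℂ} {N F : H →L[ℂ] H} {z : ℂ} :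
    z ∈ rho (M.rig c N) F M.chanMinus ↔ Function.Bijective (M.bdry c (N - z • F)) := by
  constructor
  · rintro ⟨h1, h2, -⟩
    rw [pencil_rig] at h1 h2
    refine ⟨Function.Injective.of_comp (f := M.source) h1, fun ⟨h, e⟩ => ?_⟩
    obtain ⟨f, hf⟩ := h2 h e
    exact ⟨f, M.source_injective hf⟩
  · intro h
    refine ⟨?_, fun x e => ?_, ?_⟩
    · rw [pencil_rig]
      exact M.source_injective.comp h.1
    · obtain ⟨f, hf⟩ := h.2 (x, e)
      refine ⟨f, ?_⟩
      rw [pencil_rig, rig_apply, hf, source_apply]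
    · obtain ⟨C, hC⟩ := M.exists_bound h
      refine ⟨C, fun f _ _ _ => ?_⟩
      rw [pencil_rig]
      exact hC f

/-- Isomorphisms form an open set of operators, and the boundary problem is affine in z. -/
theorem isOpen_rho_rig (c : ℂ) (N F : H →L[ℂ] H) :
    IsOpen (rho (M.rig c N) F M.chanMinus) := by
  have h1 : IsOpen (Set.range
      ((↑) : (HPlus M.herm ≃L[ℂ] H × E) → HPlus M.herm →L[ℂ] H × E)) :=
    ContinuousLinearEquiv.isOpen
  have h2 : Continuous fun z : ℂ => M.bdry c (N - z • F) := by
    have : (fun z : ℂ => M.bdry c (N - z • F)) = fun z : ℂ => M.bdry c N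
        - z • (ContinuousLinearMap.inl ℂ H E).comp (F.comp M.incl) := by
      funext z
      refine ContinuousLinearMap.ext fun f => ?_
      change M.bdry c (N - z • F) f = M.bdry c N f - z • (F (M.incl f), (0 : E))
      rw [bdry_apply, bdry_apply, Prod.smul_mk, Prod.mk_sub_mk, smul_zero, sub_zero, add_sub_assoc]
      rfl
    rw [this]
    fun_prop
  convert h1.preimage h2 using 1
  ext z
  rw [M.mem_rho_rig]
  constructor
  · intro h
    exact ⟨M.bdryEquiv h, by ext <;> rfl⟩
  · rintro ⟨e, he⟩
    dsimp only at he
    rw [← he]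
    exact e.bijective

/-! ### Coercive perturbations -/

/-- Green's identity with both arguments equal and Γ₀f = −cΓ₁f: the sign of Im c decides
dissipativity. -/
theorem im_inner_maxOp (f : HPlus M.herm) {c : ℂ} (hf : M.singular f + c • M.regular f = 0) :
    (⟪M.incl f, M.maxOp f⟫_ℂ).im = c.im * ‖M.regular f‖ ^ 2 := by
  have h := M.green f f
  rw [eq_neg_of_add_eq_zero_left hf, inner_neg_left, inner_neg_right, inner_smul_left,
    inner_smul_right, ← inner_conj_symm, inner_self_eq_norm_sq_to_K] at h
  have := congrArg Complex.im h
  simp only [Complex.add_im, Complex.neg_im, Complex.conj_im] at this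
  have e : ∀ w : ℂ, (w * ((‖M.regular f‖ : ℂ) ^ 2)).im = w.im * ‖M.regular f‖ ^ 2 := fun w => by
    rw [← Complex.ofReal_pow, Complex.im_mul_ofReal]
  have h1 := e c
  have h2 := e (conj c)
  rw [Complex.conj_im] at h2
  simp only [Complex.coe_algebraMap] at this
  linarith

theorem norm_incl_le_of_coercive {c : ℂ} {N : H →L[ℂ] H} {k : ℝ} {f : HPlus M.herm}
    (hN : k * ‖M.incl f‖ ^ 2 ≤
      |c.im * ‖M.regular f‖ ^ 2 + (⟪M.incl f, N (M.incl f)⟫_ℂ).im|)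
    (hf : M.singular f + c • M.regular f = 0) :
    k * ‖M.incl f‖ ≤ ‖M.maxOp f + N (M.incl f)‖ := by
  by_cases h0 : ‖M.incl f‖ = 0
  · rw [h0, mul_zero]; positivity
  rw [← M.im_inner_maxOp f hf, ← Complex.add_im, ← inner_add_right] at hN
  have h2 : |(⟪M.incl f, M.maxOp f + N (M.incl f)⟫_ℂ).im|
      ≤ ‖M.incl f‖ * ‖M.maxOp f + N (M.incl f)‖ :=
    (Complex.abs_im_le_norm _).trans (norm_inner_le_norm _ _)
  have h3 : 0 < ‖M.incl f‖ := lt_of_le_of_ne (norm_nonneg _) (Ne.symm h0)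
  refine le_of_mul_le_mul_right ?_ h3
  nlinarith

/-- The lower bound makes the restriction to ker(Γ₀ + cΓ₁) injective with closed range. A vector
orthogonal to the range solves the homogeneous problem for conj c and N*, whose imaginary form has
the opposite sign and obeys the same bound, so it is 0. -/
theorem bijective_of_coercive {c : ℂ} {N : H →L[ℂ] H} {k : ℝ} (hk : 0 < k)
    (hN : ∀ f, k * ‖M.incl f‖ ^ 2 ≤
      |c.im * ‖M.regular f‖ ^ 2 + (⟪M.incl f, N (M.incl f)⟫_ℂ).im|) :
    Function.Bijective (M.bdry c N) := by
  let Y : Submodule ℂ (HPlus M.herm) :=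
    LinearMap.ker ((M.singular + c • M.regular : HPlus M.herm →L[ℂ] E) : HPlus M.herm →ₗ[ℂ] E)
  have hY : ∀ f : Y, M.singular f + c • M.regular f = 0 := fun f => f.2
  have hYc : IsClosed (Y : Set (HPlus M.herm)) :=
    isClosed_eq (M.singular + c • M.regular).continuous continuous_const
  have : CompleteSpace Y := hYc.completeSpace_coe
  let Φ : Y →L[ℂ] H := (M.maxOp + N.comp M.incl).comp Y.subtypeL
  have hΦ : ∀ f : Y, Φ f = M.maxOp f + N (M.incl f) := fun f => rfl
  have hb : ∀ f : Y, k * ‖M.incl f‖ ≤ ‖Φ f‖ := fun f =>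
    M.norm_incl_le_of_coercive (hN f) (hY f)
  have hb2 : ∃ K : NNReal, AntilipschitzWith K Φ := by
    -- Add ‖f‖ ≤ ‖Φf‖/k to ‖A*f‖ ≤ ‖Φf‖ + ‖N‖ ‖f‖; the sum bounds the graph norm.
    set C : ℝ := 1 / k * (1 + ‖N‖) + 1 with hC
    have hC0 : 0 ≤ C := by positivity
    refine ⟨⟨C, hC0⟩, ContinuousLinearMap.antilipschitz_of_bound _ fun f => ?_⟩
    have h1 := M.norm_plus_le f
    have h3 : ‖M.incl f‖ ≤ 1 / k * ‖Φ f‖ := by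
      rw [one_div, inv_mul_eq_div, le_div_iff₀ hk, mul_comm]; exact hb f
    have h4 : ‖M.maxOp f‖ ≤ ‖Φ f‖ + ‖N‖ * ‖M.incl f‖ := by
      have : M.maxOp f = Φ f - N (M.incl f) := by rw [hΦ, add_sub_cancel_right]
      rw [this]
      exact (norm_sub_le _ _).trans (add_le_add_right (N.le_opNorm _) _)
    have h5 : ‖N‖ * ‖M.incl f‖ ≤ ‖N‖ * (1 / k * ‖Φ f‖) := by gcongr
    change ‖(f : HPlus M.herm)‖ ≤ C * _
    rw [hC]
    nlinarith
  obtain ⟨K, hK⟩ := hb2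
  constructor
  · rw [injective_iff_map_eq_zero]
    intro f hf
    rw [bdry_apply, Prod.mk_eq_zero] at hf
    have : Φ ⟨f, hf.2⟩ = Φ 0 := by rw [map_zero]; exact hf.1
    exact congrArg Subtype.val (hK.injective this)
  · have hcl : IsClosed (Set.range Φ) := hK.isClosed_range Φ.uniformContinuous
    have hd : (LinearMap.range (Φ : Y →ₗ[ℂ] H)).topologicalClosure = ⊤ := by
      rw [Submodule.topologicalClosure_eq_top_iff, Submodule.eq_bot_iff]
      intro y hy
      rw [Submodule.mem_orthogonal] at hy
      obtain ⟨g, hg, hg'⟩ := M.exists_of_forall (c := c) (N := N) (y := y) (w := 0)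
        fun f hf => by
          rw [inner_zero_right]
          exact hy _ ⟨⟨f, hf⟩, rfl⟩
      rw [bdry_apply, Prod.mk.injEq] at hg'
      have hN' : k * ‖M.incl g‖ ^ 2 ≤ |(conj c).im * ‖M.regular g‖ ^ 2
          + (⟪M.incl g, ContinuousLinearMap.adjoint N (M.incl g)⟫_ℂ).im| := by
        rw [ContinuousLinearMap.adjoint_inner_right, ← inner_conj_symm, Complex.conj_im,
          Complex.conj_im, neg_mul, ← neg_add, abs_neg]
        exact hN g
      have := M.norm_incl_le_of_coercive hN' hg'.2
      rw [hg'.1, norm_zero, hg] at this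
      exact norm_le_zero_iff.1 (by nlinarith [norm_nonneg y])
    have hr : Set.range Φ = Set.univ := by
      rw [← hcl.closure_eq]
      exact congrArg (fun S : Submodule ℂ H => (S : Set H)) hd
    refine M.bdry_surjective fun w => ?_
    obtain ⟨f, hf⟩ : w ∈ Set.range Φ := by rw [hr]; trivial
    exact ⟨f, by rw [bdry_apply, hY f, ← hΦ, hf]⟩

end SingularChannel

namespace SingularChannel

variable {E H : Type u} [NormedAddCommGroup E] [InnerProductSpace ℂ E] [CompleteSpace E]
  [NormedAddCommGroup H] [InnerProductSpace ℂ H] [CompleteSpace H] (M : SingularChannel E H)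

theorem adjoint_F : ContinuousLinearMap.adjoint M.F = M.F := by
  refine ((ContinuousLinearMap.eq_adjoint_iff M.F M.F).2 M.F_symm).symm

variable [FiniteDimensional ℂ E]

/-! ### The extensions of the Hermitian operator -/

/-- The graph of the restriction of `A*` to the kernel of `Γ₀ + c Γ₁`. -/
def extGraph (c : ℂ) : Submodule ℂ (H × H) :=
  (LinearMap.ker ((M.singular + c • M.regular : HPlus M.herm →L[ℂ] E) :
    HPlus M.herm →ₗ[ℂ] E)).map ((M.incl.prod M.maxOp : HPlus M.herm →L[ℂ] H × H) :
    HPlus M.herm →ₗ[ℂ] H × H)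

theorem mem_extGraph {c : ℂ} {x v : H} : (x, v) ∈ M.extGraph c ↔
    ∃ f, M.singular f + c • M.regular f = 0 ∧ M.incl f = x ∧ M.maxOp f = v := by
  constructor
  · rintro ⟨f, hf, h⟩
    exact ⟨f, hf, congrArg Prod.fst h, congrArg Prod.snd h⟩
  · rintro ⟨f, hf, rfl, rfl⟩
    exact ⟨f, hf, rfl⟩

theorem extGraph_single {c : ℂ} {w : H} (h : ((0 : H), w) ∈ M.extGraph c) : w = 0 := by
  obtain ⟨f, -, hf, rfl⟩ := M.mem_extGraph.1 h
  rw [M.incl_injective (hf.trans (map_zero M.incl).symm), map_zero]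

/-- The restriction of `A*` to the kernel of `Γ₀ + c Γ₁`. -/
def ext (c : ℂ) : H →ₗ.[ℂ] H := (M.extGraph c).toLinearPMap

theorem ext_graph (c : ℂ) : (M.ext c).graph = M.extGraph c := by
  refine Submodule.toLinearPMap_graph_eq _ ?_
  rintro ⟨x, v⟩ h rfl
  exact M.extGraph_single h

theorem hermGraph_le_extGraph (c : ℂ) : M.hermGraph ≤ M.extGraph c := by
  rintro ⟨x, v⟩ hx
  refine M.mem_extGraph.2 ⟨M.toPlus hx.1 0, ?_, ?_, ?_⟩
  · rw [singular_toPlus, regular_toPlus, show M.chan (x, v) = 0 from hx.2]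
    simp
  · rw [incl_toPlus, map_zero, add_zero]
  · rw [maxOp_toPlus, map_zero, sub_zero]

theorem dense_extGraph (c : ℂ) : Dense {x : H | ∃ v, (x, v) ∈ M.extGraph c} := by
  refine M.dense_herm.mono fun x hx => ?_
  obtain ⟨v, hv⟩ := mem_toLinearPMap_domain.1 hx
  exact ⟨v, M.hermGraph_le_extGraph c hv⟩

theorem dense_ext (c : ℂ) : Dense ((M.ext c).domain : Set H) := by
  convert M.dense_extGraph c using 1
  ext x
  exact mem_toLinearPMap_domain

/-- Green's identity gives one inclusion, the strong solvability of the weak adjoint problem with N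
= 0 the other. -/
theorem adjoint_ext (c : ℂ) : (M.ext c).adjoint = M.ext (conj c) := by
  refine toLinearPMap_adjoint_eq (fun w => M.extGraph_single) (M.dense_extGraph c) fun y w => ?_
  constructor
  · intro hy x v hx
    obtain ⟨g, hg, rfl, rfl⟩ := M.mem_extGraph.1 hy
    obtain ⟨f, hf, rfl, rfl⟩ := M.mem_extGraph.1 hx
    have h := M.green f g
    rw [eq_neg_of_add_eq_zero_left hf, eq_neg_of_add_eq_zero_left hg, inner_neg_left,
      inner_neg_right, inner_smul_left, inner_smul_right] at h
    linear_combination h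
  · intro h
    obtain ⟨g, hg, hg'⟩ := M.exists_of_forall (c := c) (N := 0) (y := y) (w := w) fun f hf => by
      rw [zero_apply, add_zero]
      exact h _ _ (M.mem_extGraph.2 ⟨f, hf, rfl, rfl⟩)
    rw [bdry_apply, Prod.mk.injEq] at hg'
    refine M.mem_extGraph.2 ⟨g, hg'.2, hg, ?_⟩
    simpa using hg'.1

theorem isClosed_ext (c : ℂ) : (M.ext c).IsClosed := by
  have h := M.adjoint_ext (conj c)
  rw [Complex.conj_conj] at h
  rw [← h]
  exact LinearPMap.adjoint_isClosed (M.dense_ext _)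

theorem ext_mem (c : ℂ) (x : (M.ext c).domain) : ((x : H), M.ext c x) ∈ M.extGraph c := by
  rw [← ext_graph]
  exact LinearPMap.mem_graph _ x

/-- T and T* carry the conditions Γ₀ ± iΓ₁ = 0; together they say Γ₀f = Γ₁f = 0, that is, f lies in
dom S with vanishing channel functional. -/
theorem herm_graph_eq :
    M.herm.graph = (M.ext Complex.I).graph ⊓ (M.ext Complex.I).adjoint.graph := by
  rw [adjoint_ext, Complex.conj_I, herm_graph, ext_graph, ext_graph]
  refine le_antisymm (le_inf (M.hermGraph_le_extGraph _) (M.hermGraph_le_extGraph _)) ?_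
  rintro ⟨x, v⟩ ⟨h1, h2⟩
  obtain ⟨f, hf, hx, hv⟩ := M.mem_extGraph.1 h1
  obtain ⟨g, hg, hx', -⟩ := M.mem_extGraph.1 h2
  obtain rfl := M.incl_injective (hx.trans hx'.symm)
  have h3 : (2 : ℂ) • M.singular f = 0 := by
    have := congrArg₂ (· + ·) hf hg
    simp only [add_zero] at this
    rw [← this]
    module
  have h4 : M.singular f = 0 := (smul_eq_zero.1 h3).resolve_left two_ne_zero
  have h5 : M.regular f = 0 := by
    rw [h4, zero_add] at hf
    exact (smul_eq_zero.1 hf).resolve_left Complex.I_ne_zero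
  have h6 := M.singular_spec f
  rw [h4, map_zero, map_zero, sub_zero, add_zero, hx, hv] at h6
  refine ⟨h6, ?_⟩
  have h7 := M.regular_apply f
  rw [h5, h4, map_zero, map_zero, add_zero, add_zero, hx, hv] at h7
  exact h7.symm

theorem rigExtends_ext (c : ℂ) : RigExtends (M.ext c) (M.rig c 0) := by
  intro x
  obtain ⟨f, hf, hx, hv⟩ := M.mem_extGraph.1 (M.ext_mem c x)
  refine ⟨f, hx, ?_⟩
  rw [rig_apply, bdry_apply, hf, source_apply, map_zero, add_zero, hv,
    zero_apply, add_zero]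

theorem rigExtends_herm (c : ℂ) : RigExtends M.herm (M.rig c 0) := by
  intro x
  obtain ⟨f, hf, hx, hv⟩ := M.mem_extGraph.1 (M.hermGraph_le_extGraph c (M.herm_mem x))
  refine ⟨f, hx, ?_⟩
  rw [rig_apply, bdry_apply, hf, source_apply, map_zero, add_zero, hv,
    zero_apply, add_zero]

/-! ### The system conditions -/

theorem isSelfAdjointBiExtension_rig : IsSelfAdjointBiExtension M.herm (M.rig 0 0) where
  ext := M.rigExtends_herm 0
  ext_adjoint := by
    rw [rigAdjoint_rig, map_zero, map_zero]
    exact M.rigExtends_herm 0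
  selfAdjoint := by rw [rigAdjoint_rig, map_zero, map_zero]
  restriction := by
    refine ⟨M.ext 0, M.dense_ext 0, ?_, ?_, fun x h => ?_⟩
    · rw [adjoint_ext, map_zero]
    · refine LinearPMap.le_of_le_graph ?_
      rw [herm_graph, ext_graph]
      exact M.hermGraph_le_extGraph 0
    -- A*f + KΓ₀f lies in H exactly when Γ₀f = 0, because H + ran K is direct.
    · rw [ext_graph, mem_extGraph]
      refine exists_congr fun f => ?_
      have h1 : M.rig 0 0 f = M.source (M.maxOp f, M.singular f) := by
        rw [rig_apply, bdry_apply, zero_smul, add_zero, zero_apply, add_zero]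
      have h2 : inclMinus M.herm h = M.source (h, 0) := by
        rw [source_apply, map_zero, add_zero]
      rw [h1, h2, M.source_injective.eq_iff, Prod.mk.injEq, zero_smul, add_zero]
      tauto

theorem rigReal_rig : rigReal (M.rig Complex.I 0) = M.rig 0 0 := by
  rw [rigReal, rigAdjoint_rig, Complex.conj_I, map_zero]
  refine ContinuousLinearMap.ext fun f => ContinuousLinearMap.ext fun g => ?_
  change (1 / 2 : ℂ) * (M.rig Complex.I 0 f g + M.rig (-Complex.I) 0 f g) = _
  rw [rig_apply_apply, rig_apply_apply, rig_apply_apply]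
  ring

/-- For c = i and N = i both contributions to the imaginary part are nonnegative, so coercivity
holds with constant 1. -/
theorem isRegularPoint_ext : IsRegularPoint (M.ext Complex.I) (-Complex.I) := by
  have hb : Function.Bijective (M.bdry Complex.I (Complex.I • 1)) := by
    refine M.bijective_of_coercive one_pos fun f => ?_
    have : (⟪M.incl f, (Complex.I • (1 : H →L[ℂ] H)) (M.incl f)⟫_ℂ).im = ‖M.incl f‖ ^ 2 := by
      rw [smul_apply, one_apply_eq_self, inner_smul_right,
        inner_self_eq_norm_sq_to_K, Complex.I_mul_im]
      change ((‖M.incl f‖ : ℂ) ^ 2).re = _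
      rw [← Complex.ofReal_pow, Complex.ofReal_re]
    rw [this, Complex.I_im, one_mul, one_mul]
    exact le_trans (by nlinarith [norm_nonneg (M.regular f)]) (le_abs_self _)
  refine ⟨M.incl.comp (((M.bdryEquiv hb).symm : H × E →L[ℂ] HPlus M.herm).comp
      (ContinuousLinearMap.inl ℂ H E)), fun x h => ?_⟩
  have hval : ∀ f, M.bdry Complex.I (Complex.I • 1) f
      = (M.maxOp f - (-Complex.I) • M.incl f, M.singular f + Complex.I • M.regular f) := fun f => by
    rw [bdry_apply, neg_smul, sub_neg_eq_add]
    rfl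
  have hR : (M.incl.comp (((M.bdryEquiv hb).symm : H × E →L[ℂ] HPlus M.herm).comp
      (ContinuousLinearMap.inl ℂ H E))) h = M.incl ((M.bdryEquiv hb).symm (h, 0)) := rfl
  rw [hR]
  constructor
  · rintro rfl
    set f := (M.bdryEquiv hb).symm (h, 0) with hf
    have h1 := M.bdry_bdryEquiv_symm hb (h, 0)
    rw [← hf, hval, Prod.mk.injEq] at h1
    have h2 : (M.incl f, M.maxOp f) ∈ (M.ext Complex.I).graph := by
      rw [ext_graph]
      exact M.mem_extGraph.2 ⟨f, h1.2, rfl, rfl⟩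
    obtain ⟨y, hy, hy'⟩ := (LinearPMap.mem_graph_iff _).1 h2
    have hm : M.incl f ∈ (M.ext Complex.I).domain := LinearPMap.mem_domain_of_mem_graph h2
    refine ⟨hm, ?_⟩
    rw [← h1.1, ← show M.ext Complex.I y = M.maxOp f from hy']
    congr 2
    exact Subtype.ext hy.symm
  · rintro ⟨hx, rfl⟩
    obtain ⟨f, hf, hfx, hfv⟩ := M.mem_extGraph.1 (M.ext_mem Complex.I ⟨x, hx⟩)
    have h1 := hval f
    rw [hf, hfx, hfv, ← M.bdryEquiv_apply hb, ← ContinuousLinearEquiv.eq_symm_apply] at h1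
    rw [← h1, hfx]

theorem memOmega_ext : MemOmega M.herm (M.ext Complex.I) where
  closed := M.isClosed_ext _
  dense := M.dense_ext _
  inter := M.herm_graph_eq
  regular := M.isRegularPoint_ext

theorem isCorrectStarExtension_rig :
    IsCorrectStarExtension M.herm (M.ext Complex.I) (M.rig Complex.I 0) where
  starExtension :=
    { ext := M.rigExtends_ext _
      ext_adjoint := by
        rw [adjoint_ext, rigAdjoint_rig, map_zero]
        exact M.rigExtends_ext _ }
  correct := by
    rw [rigReal_rig]
    exact M.isSelfAdjointBiExtension_rig

theorem rig_I : M.rig Complex.I 0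
    = M.rig 0 0 + Complex.I • M.chanMinus.comp (chanAdjoint M.chanMinus) := by
  rw [chanAdjoint_chanMinus]
  refine ContinuousLinearMap.ext fun f => ContinuousLinearMap.ext fun g => ?_
  change _ = M.rig 0 0 f g + Complex.I * M.chanMinus (M.regular f) g
  rw [rig_apply_apply, rig_apply_apply, chanMinus_apply]
  ring

/-- The pair (F, F') preserves `op` and fixes βe and αe, so the singular coefficient e is unchanged.
-/
theorem plusProj_mem {p : WithLp 2 (H × H)} (hp : p ∈ plusSpace M.herm) :
    WithLp.toLp 2 (M.F p.fst, M.F' p.snd) ∈ plusSpace M.herm := by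
  obtain ⟨e, he⟩ := M.mem_plusSpace.1 hp
  refine M.mem_plusSpace.2 ⟨e, ?_⟩
  have := M.F_op _ _ he
  rwa [map_sub, map_add, M.F_β, M.F'_α] at this

/-- The projection in `H₊` induced by `F`. -/
def plusProj : HPlus M.herm →L[ℂ] HPlus M.herm :=
  (((WithLp.prodContinuousLinearEquiv 2 ℂ H H).symm : H × H →L[ℂ] WithLp 2 (H × H)).comp
    ((M.F.comp M.incl).prod (M.F'.comp M.maxOp))).codRestrict _ fun f => M.plusProj_mem f.2

theorem isRiggedProjection_F : IsRiggedProjection M.herm M.F where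
  idem := M.F_idem
  symm := M.F_symm
  plus := by
    refine ⟨M.plusProj, fun f => rfl, fun f => ?_, fun f g => ?_⟩
    · exact M.incl_injective (M.F_idem _)
    · rw [Submodule.coe_inner, Submodule.coe_inner, WithLp.prod_inner_apply,
        WithLp.prod_inner_apply]
      exact congrArg₂ (· + ·) (M.F_symm _ _) (M.F'_symm _ _)

theorem conj_mem_rho_rig {c z : ℂ} (h : z ∈ rho (M.rig c 0) M.F M.chanMinus) :
    conj z ∈ rho (rigAdjoint (M.rig c 0)) M.F M.chanMinus := by
  rw [rigAdjoint_rig, mem_rho_rig]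
  have := M.bijective_adjoint (M.mem_rho_rig.1 h)
  rwa [map_sub, map_smulₛₗ, adjoint_F] at this

theorem isDeltaSystem_rig : IsDeltaSystem M.herm (M.rig 0 0) M.F M.chanMinus where
  closedHermitian := M.isClosedHermitian_herm
  biExtension := M.isSelfAdjointBiExtension_rig
  injective := M.chanMinus_injective
  projection := M.isRiggedProjection_F
  isOpen_rho := M.isOpen_rho_rig _ _ _

theorem isScatteringFSystem_rig :
    IsScatteringFSystem M.herm (M.rig Complex.I 0) M.F M.chanMinus where
  closedHermitian := M.isClosedHermitian_herm
  correct := ⟨_, M.memOmega_ext, M.isCorrectStarExtension_rig⟩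
  J_adjoint := ContinuousLinearMap.adjoint_id
  J_involution := one_mul 1
  conservative := by
    rw [rigAdjoint_rig, map_zero, Complex.conj_I, chanAdjoint_chanMinus]
    refine ContinuousLinearMap.ext fun f => ContinuousLinearMap.ext fun g => ?_
    change M.rig Complex.I 0 f g - M.rig (-Complex.I) 0 f g
      = (2 * Complex.I) * M.chanMinus (M.regular f) g
    rw [rig_apply_apply, rig_apply_apply, chanMinus_apply]
    ring
  injective := M.chanMinus_injective
  projection := M.isRiggedProjection_F
  isOpen_rho := M.isOpen_rho_rig _ _ _
  isOpen_rho_real := by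
    rw [rigReal_rig]
    exact M.isOpen_rho_rig _ _ _
  isOpen_inter := by
    rw [rigReal_rig]
    exact (M.isOpen_rho_rig _ _ _).inter (M.isOpen_rho_rig _ _ _)
  conj_mem := fun z hz => M.conj_mem_rho_rig hz
  conj_mem_real := fun z hz => by
    rw [rigReal_rig] at hz ⊢
    have := M.conj_mem_rho_rig hz
    rwa [rigAdjoint_rig, map_zero, map_zero] at this

/-! ### The transfer function -/

/-- For c = 0 the homogeneous boundary condition is Γ₀f = 0, which leaves the pencil S − zF. -/
theorem bijective_bdry_zero {z : ℂ} (hz : z.im ≠ 0) :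
    Function.Bijective (M.bdry 0 (0 - z • M.F)) := by
  have hval : ∀ f, M.bdry 0 (0 - z • M.F) f = (M.maxOp f - z • M.F (M.incl f), M.singular f) := by
    intro f
    rw [bdry_apply, zero_smul, add_zero, zero_sub, sub_eq_add_neg]
    rfl
  constructor
  · rw [injective_iff_map_eq_zero]
    intro f hf
    rw [hval, Prod.mk_eq_zero, sub_eq_zero] at hf
    have h1 := M.singular_spec f
    rw [hf.2, map_zero, map_zero, sub_zero, add_zero, hf.1] at h1
    refine M.incl_injective ?_
    rw [M.pencil_injective z hz _ h1, map_zero]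
  · refine M.bdry_surjective fun w => ?_
    obtain ⟨x, hx⟩ := M.pencil_surjective z hz w
    refine ⟨M.toPlus hx 0, ?_⟩
    rw [hval, singular_toPlus, incl_toPlus, maxOp_toPlus]
    simp

theorem mem_rho_of_im_ne_zero {z : ℂ} (hz : z.im ≠ 0) :
    z ∈ rho (M.rig 0 0) M.F M.chanMinus :=
  M.mem_rho_rig.2 (M.bijective_bdry_zero hz)

theorem compressedResolvent_eq {c z : ℂ}
    (hz : z ∈ rho (M.rig c 0) M.F M.chanMinus) {e : E} {f : HPlus M.herm}
    (hf : M.bdry c (0 - z • M.F) f = (0, e)) :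
    compressedResolvent (M.rig c 0) M.F M.chanMinus z e = M.regular f := by
  have h1 : M.chanMinus e = pencil (M.rig c 0) M.F z f := by
    rw [pencil_rig, rig_apply, hf, source_apply, map_zero, zero_add]
  change chanAdjoint M.chanMinus (pencilInv (M.rig c 0) M.F z (M.chanMinus e)) = _
  rw [h1, pencilInv_pencil _ _ _ hz.1, chanAdjoint_chanMinus]

/-- `V` is the Weyl function of the pencil `A* - z F`. -/
def IsWeylFunction (V : ℂ → E →L[ℂ] E) : Prop :=
  ∀ z : ℂ, z.im ≠ 0 → ∀ f : HPlus M.herm, M.maxOp f = z • M.F (M.incl f) →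
    M.regular f = V z (M.singular f)

variable {M} {V : ℂ → E →L[ℂ] E}

/-- One solution for each e suffices, since A*f = zFf with prescribed Γ₀f has only one solution. -/
theorem IsWeylFunction.of_exists (h : ∀ z : ℂ, z.im ≠ 0 → ∀ e : E, ∃ x v, (x, v) ∈ M.op ∧
    v - M.α e = z • M.F (x + M.β e) ∧
    M.chan (x, v) + ContinuousLinearMap.adjoint M.α (M.β e) + M.Q₀ e = V z e) :
    M.IsWeylFunction V := by
  intro z hz f hf
  obtain ⟨x, v, hx, h1, h2⟩ := h z hz (M.singular f)
  have : M.toPlus hx (M.singular f) = f := by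
    refine (M.bijective_bdry_zero hz).1 ?_
    rw [bdry_apply, bdry_apply, singular_toPlus, maxOp_toPlus, incl_toPlus, h1, hf]
    simp
  rw [← h2, ← M.regular_toPlus hx, this]

theorem bdry_eq_iff {c z : ℂ} {f : HPlus M.herm} {e : E} :
    M.bdry c (0 - z • M.F) f = (0, e) ↔
      M.maxOp f = z • M.F (M.incl f) ∧ M.singular f = e - c • M.regular f := by
  rw [bdry_apply, Prod.mk.injEq, ← sub_eq_zero (a := M.maxOp f), eq_sub_iff_add_eq, zero_sub,
    sub_eq_add_neg]
  rfl

theorem IsWeylFunction.impedance_eq (hV : M.IsWeylFunction V) {z : ℂ} (hz : z.im ≠ 0) :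
    V z = compressedResolvent (M.rig 0 0) M.F M.chanMinus z := by
  refine ContinuousLinearMap.ext fun e => ?_
  obtain ⟨f, hf⟩ := (M.bijective_bdry_zero hz).2 (0, e)
  rw [M.compressedResolvent_eq (M.mem_rho_of_im_ne_zero hz) hf]
  obtain ⟨h1, h2⟩ := bdry_eq_iff.1 hf
  rw [hV z hz f h1, h2, zero_smul, sub_zero]

/-- On solutions of A*f = zFf one has Γ₀f + iΓ₁f = (1 + iV)Γ₀f, so invertibility of 1 + iV transfers
unique solvability from the boundary condition on Γ₀ to that on Γ₀ + iΓ₁. -/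
theorem IsWeylFunction.mem_rho_of_isUnit (hV : M.IsWeylFunction V) {z : ℂ} (hz : z.im ≠ 0)
    (h : IsUnit (1 + Complex.I • V z)) :
    z ∈ rho (M.rig Complex.I 0) M.F M.chanMinus := by
  rw [mem_rho_rig]
  obtain ⟨U, hU⟩ := h
  have hl : ∀ a, U.inv ((1 + Complex.I • V z) a) = a := fun a => by
    rw [← hU]
    exact congrArg (fun T : E →L[ℂ] E => T a) U.inv_val
  have hr : ∀ a, (1 + Complex.I • V z) (U.inv a) = a := fun a => by
    rw [← hU]
    exact congrArg (fun T : E →L[ℂ] E => T a) U.val_inv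
  have hval : ∀ a, (1 + Complex.I • V z) a = a + Complex.I • V z a := fun a => rfl
  have hb := M.bijective_bdry_zero hz
  constructor
  · rw [injective_iff_map_eq_zero]
    intro f hf
    obtain ⟨h1, h2⟩ := bdry_eq_iff.1 hf
    rw [hV z hz f h1, zero_sub] at h2
    have h3 : M.singular f = 0 := by
      rw [← hl (M.singular f), hval]
      nth_rewrite 1 [h2]
      rw [neg_add_cancel, map_zero]
    refine hb.1 ?_
    rw [map_zero]
    exact bdry_eq_iff.2 ⟨h1, by rw [h3]; simp⟩
  · refine M.bdry_surjective fun w => ?_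
    obtain ⟨f, hf⟩ := hb.2 (w, 0)
    -- f solves the equation in H with Γ₀f = 0; the homogeneous solution g is chosen so that (1 +
    -- iV)Γ₀g cancels iΓ₁f.
    obtain ⟨g, hg⟩ := hb.2 (0, U.inv (-(Complex.I • M.regular f)))
    obtain ⟨h1, h2⟩ := bdry_eq_iff.1 hg
    rw [zero_smul, sub_zero] at h2
    have h3 := hV z hz g h1
    rw [bdry_apply, Prod.mk.injEq] at hf hg
    refine ⟨f + g, ?_⟩
    rw [bdry_apply, Prod.mk.injEq]
    constructor
    · rw [map_add, map_add, map_add, add_add_add_comm, hf.1, hg.1, add_zero]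
    · have h4 := hr (-(Complex.I • M.regular f))
      rw [hval, ← h2, ← h3] at h4
      have h5 := hf.2
      rw [zero_smul, add_zero] at h5
      rw [map_add, map_add, smul_add, h5, zero_add]
      rw [add_left_comm, h4, add_neg_cancel]

/-- If f solves the problem with data (0, e), then Xe = Γ₁f and Γ₀f = e − iXe, so X = V(1 − iX) and
(1 + iV)(1 − iX) = 1. Now W + 1 = 2(1 − iX) has inverse (1 + iV)/2, W − 1 = −2iX, and (1 + iV)X = V.
-/
theorem IsWeylFunction.transfer_eq (hV : M.IsWeylFunction V) {z : ℂ} (hz : z.im ≠ 0)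
    (h : z ∈ rho (M.rig Complex.I 0) M.F M.chanMinus) :
    IsUnit (transferFunction (M.rig Complex.I 0) M.F M.chanMinus 1 z + 1) ∧
      V z = Complex.I •
        (Ring.inverse (transferFunction (M.rig Complex.I 0) M.F M.chanMinus 1 z + 1) *
          (transferFunction (M.rig Complex.I 0) M.F M.chanMinus 1 z - 1)) := by
  set X := compressedResolvent (M.rig Complex.I 0) M.F M.chanMinus z with hX
  have hW : transferFunction (M.rig Complex.I 0) M.F M.chanMinus 1 z
      = 1 - (2 * Complex.I) • X := by
    rw [transferFunction, mul_one]
  have hXV : X = V z * (1 - Complex.I • X) := by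
    refine ContinuousLinearMap.ext fun e => ?_
    obtain ⟨f, hf⟩ := (M.mem_rho_rig.1 h).2 (0, e)
    have h1 : X e = _ := M.compressedResolvent_eq h hf
    obtain ⟨h2, h3⟩ := bdry_eq_iff.1 hf
    have h4 := hV z hz f h2
    rw [h3, ← h1] at h4
    exact h4
  have h1 : (1 + Complex.I • V z) * (1 - Complex.I • X) = 1 := by
    rw [add_mul, one_mul, smul_mul_assoc, ← hXV, sub_add_cancel]
  have h2 : (1 - Complex.I • X) * (1 + Complex.I • V z) = 1 := by
    -- In finite dimension a one-sided inverse is two-sided.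
    have hl : ((1 + Complex.I • V z : E →L[ℂ] E) : E →ₗ[ℂ] E)
        * ((1 - Complex.I • X : E →L[ℂ] E) : E →ₗ[ℂ] E) = 1 :=
      LinearMap.ext fun x => congrArg (fun T : E →L[ℂ] E => T x) h1
    exact ContinuousLinearMap.ext fun x => LinearMap.congr_fun (mul_eq_one_comm.1 hl) x
  have h0 : 1 - (2 * Complex.I) • X + 1 = (2 : ℂ) • (1 - Complex.I • X) := by module
  have h3 : (1 - (2 * Complex.I) • X + 1) * ((1 / 2 : ℂ) • (1 + Complex.I • V z)) = 1 := by
    rw [h0, smul_mul_smul_comm, h2]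
    norm_num
  have h4 : ((1 / 2 : ℂ) • (1 + Complex.I • V z)) * (1 - (2 * Complex.I) • X + 1) = 1 := by
    rw [h0, smul_mul_smul_comm, h1]
    norm_num
  have hinv := Ring.inverse_unit (⟨_, _, h3, h4⟩ : (E →L[ℂ] E)ˣ)
  rw [hW]
  refine ⟨⟨⟨_, _, h3, h4⟩, rfl⟩, ?_⟩
  rw [hinv]
  have h5 : (1 + Complex.I • V z) * X = V z := by
    have e1 : Complex.I • ((1 + Complex.I • V z) * X) = Complex.I • V z := by
      have h6 := h1
      rw [mul_sub, mul_one, mul_smul_comm] at h6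
      exact (add_left_cancel (sub_eq_iff_eq_add.1 h6)).symm
    have := congrArg (fun T => (-Complex.I) • T) e1
    simpa [smul_smul] using this
  change V z = Complex.I • (((1 / 2 : ℂ) • (1 + Complex.I • V z)) * _)
  rw [sub_sub_cancel_left, smul_mul_assoc, mul_neg, mul_smul_comm, h5, smul_neg, smul_neg,
    smul_smul, smul_smul, ← neg_smul]
  nth_rewrite 1 [← one_smul ℂ (V z)]
  congr 1
  linear_combination Complex.I_mul_I

/-- By symmetry Im V ≤ 0 below the real axis, so Re⟪x, (1 + iV)x⟫ = ‖x‖² − Im⟪x, Vx⟫ ≥ ‖x‖². -/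
theorem IsWeylFunction.mem_rho_of_im_neg (hV : M.IsWeylFunction V)
    (hHN : IsHerglotzNevanlinna V) {z : ℂ} (hz : z.im < 0) :
    z ∈ rho (M.rig Complex.I 0) M.F M.chanMinus := by
  refine hV.mem_rho_of_isUnit hz.ne ?_
  have him : ∀ x, (⟪x, V z x⟫_ℂ).im ≤ 0 := by
    intro x
    have h1 := hHN.im_nonneg (conj z) (by rw [Complex.conj_im]; linarith) x
    rw [← hHN.symmetric z hz.ne, ContinuousLinearMap.adjoint_inner_right, ← inner_conj_symm,
      Complex.conj_im] at h1
    linarith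
  have hinj : Function.Injective ((1 + Complex.I • V z : E →L[ℂ] E) : E →ₗ[ℂ] E) := by
    rw [injective_iff_map_eq_zero]
    intro x hx
    have hx' : x + Complex.I • V z x = 0 := hx
    have h1 : ⟪x, x + Complex.I • V z x⟫_ℂ = 0 := by rw [hx', inner_zero_right]
    rw [inner_add_right, inner_smul_right, inner_self_eq_norm_sq_to_K] at h1
    have h2 := congrArg Complex.re h1
    rw [Complex.add_re, Complex.I_mul_re, Complex.zero_re] at h2
    change ((‖x‖ : ℂ) ^ 2).re + _ = 0 at h2
    rw [← Complex.ofReal_pow, Complex.ofReal_re] at h2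
    have h3 := him x
    exact norm_eq_zero.1 (by nlinarith [norm_nonneg x])
  have hu : IsUnit ((1 + Complex.I • V z : E →L[ℂ] E) : E →ₗ[ℂ] E) :=
    (LinearMap.isUnit_iff_ker_eq_bot _).2 (LinearMap.ker_eq_bot.2 hinj)
  have := hu.map (Module.End.toContinuousLinearMap E)
  exact this

end SingularChannel

/-! ### The block model -/

/-- The data of the block model: `R = (S + i)⁻¹` for a self-adjoint operator `S` in `H₁`, an
injective self-adjoint operator `W` in `G`, and channel maps. -/
structure BlockData (E H₁ G : Type u) [NormedAddCommGroup E] [InnerProductSpace ℂ E]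
    [CompleteSpace E] [NormedAddCommGroup H₁] [InnerProductSpace ℂ H₁] [CompleteSpace H₁]
    [NormedAddCommGroup G] [InnerProductSpace ℂ G] [CompleteSpace G] where
  /-- the resolvent at `-i` -/
  R : H₁ →L[ℂ] H₁
  -- R* − R = 2iRR* = 2iR*R, the resolvent identities between −i and i; they encode the
  -- self-adjointness of S in terms of bounded operators.
  adjoint_R : ∀ x, ContinuousLinearMap.adjoint R x
    = R x + (2 * Complex.I) • R (ContinuousLinearMap.adjoint R x)
  adjoint_R' : ∀ x, ContinuousLinearMap.adjoint R x
    = R x + (2 * Complex.I) • ContinuousLinearMap.adjoint R (R x)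
  R_injective : ∀ x, R x = 0 → x = 0
  /-- the inverse of the self-adjoint operator in `G` -/
  W : G →L[ℂ] G
  W_symm : ∀ x y, ⟪W x, y⟫_ℂ = ⟪x, W y⟫_ℂ
  W_injective : ∀ x, W x = 0 → x = 0
  /-- the regular channel map into `H₁` -/
  α : E →L[ℂ] H₁
  /-- the singular channel map into `H₁` -/
  β : E →L[ℂ] H₁
  /-- the channel map into `G` -/
  γ : E →L[ℂ] G
  γ_singular : ∀ e x, γ e = W x → e = 0
  /-- the constant term -/
  Q₀ : E →L[ℂ] E
  Q₀_symm : ∀ e e', ⟪Q₀ e, e'⟫_ℂ = ⟪e, Q₀ e'⟫_ℂ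

namespace BlockData

variable {E H₁ G : Type u} [NormedAddCommGroup E] [InnerProductSpace ℂ E]
    [NormedAddCommGroup H₁] [InnerProductSpace ℂ H₁]
    [NormedAddCommGroup G] [InnerProductSpace ℂ G]

/-- The space of the block model. -/
abbrev Space (H₁ G : Type u) : Type u := WithLp 2 (H₁ × WithLp 2 (G × G))

/-- A vector of the block model. -/
abbrev vec (a : H₁) (b c : G) : Space H₁ G := WithLp.toLp 2 (a, WithLp.toLp 2 (b, c))

theorem inner_eq (x y : Space H₁ G) : ⟪x, y⟫_ℂ
    = ⟪x.fst, y.fst⟫_ℂ + (⟪x.snd.fst, y.snd.fst⟫_ℂ + ⟪x.snd.snd, y.snd.snd⟫_ℂ) := by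
  rw [WithLp.prod_inner_apply, WithLp.prod_inner_apply]
  rfl

/-- A bounded operator into the space of the block model. -/
def vecL {X : Type u} [NormedAddCommGroup X] [InnerProductSpace ℂ X] (a : X →L[ℂ] H₁)
    (b c : X →L[ℂ] G) : X →L[ℂ] Space H₁ G :=
  ((WithLp.prodContinuousLinearEquiv 2 ℂ H₁ (WithLp 2 (G × G))).symm :
      H₁ × WithLp 2 (G × G) →L[ℂ] Space H₁ G).comp
    (a.prod (((WithLp.prodContinuousLinearEquiv 2 ℂ G G).symm : G × G →L[ℂ] WithLp 2 (G × G)).comp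
      (b.prod c)))

/-- The first coordinate. -/
def fstL (H₁ G : Type u) [NormedAddCommGroup H₁] [InnerProductSpace ℂ H₁]
    [NormedAddCommGroup G] [InnerProductSpace ℂ G] : Space H₁ G →L[ℂ] H₁ := WithLp.fstL 2 ℂ _ _

/-- The second coordinate. -/
def sndL (H₁ G : Type u) [NormedAddCommGroup H₁] [InnerProductSpace ℂ H₁]
    [NormedAddCommGroup G] [InnerProductSpace ℂ G] : Space H₁ G →L[ℂ] G :=
  (WithLp.fstL 2 ℂ G G).comp (WithLp.sndL 2 ℂ _ _)

/-- The third coordinate. -/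
def trdL (H₁ G : Type u) [NormedAddCommGroup H₁] [InnerProductSpace ℂ H₁]
    [NormedAddCommGroup G] [InnerProductSpace ℂ G] : Space H₁ G →L[ℂ] G :=
  (WithLp.sndL 2 ℂ G G).comp (WithLp.sndL 2 ℂ _ _)

variable [CompleteSpace E] [CompleteSpace H₁] [CompleteSpace G] (d : BlockData E H₁ G)

/-- The graph of the self-adjoint operator of the block model. -/
def op : Submodule ℂ (Space H₁ G × Space H₁ G) where
  -- The first condition is (S + i)x = v + ix; the other two describe the off-diagonal operator (Wb,
  -- Wa) ↦ (a, b) on G ⊕ G.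
  carrier := {p | p.1.fst = d.R (p.2.fst + Complex.I • p.1.fst) ∧
    p.1.snd.fst = d.W p.2.snd.snd ∧ p.1.snd.snd = d.W p.2.snd.fst}
  zero_mem' := by simp
  add_mem' := by
    rintro p q ⟨h1, h2, h3⟩ ⟨h1', h2', h3'⟩
    refine ⟨?_, ?_, ?_⟩
    · change p.1.fst + q.1.fst = d.R (p.2.fst + q.2.fst + Complex.I • (p.1.fst + q.1.fst))
      nth_rewrite 1 [h1, h1']
      rw [← map_add]
      congr 1
      module
    · change p.1.snd.fst + q.1.snd.fst = d.W (p.2.snd.snd + q.2.snd.snd)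
      rw [h2, h2', map_add]
    · change p.1.snd.snd + q.1.snd.snd = d.W (p.2.snd.fst + q.2.snd.fst)
      rw [h3, h3', map_add]
  smul_mem' := by
    rintro c p ⟨h1, h2, h3⟩
    refine ⟨?_, ?_, ?_⟩
    · change c • p.1.fst = d.R (c • p.2.fst + Complex.I • c • p.1.fst)
      nth_rewrite 1 [h1]
      rw [← map_smul]
      congr 1
      module
    · change c • p.1.snd.fst = d.W (c • p.2.snd.snd)
      rw [h2, map_smul]
    · change c • p.1.snd.snd = d.W (c • p.2.snd.fst)
      rw [h3, map_smul]

theorem mem_op {x v : Space H₁ G} : (x, v) ∈ d.op ↔ x.fst = d.R (v.fst + Complex.I • x.fst) ∧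
    x.snd.fst = d.W v.snd.snd ∧ x.snd.snd = d.W v.snd.fst := Iff.rfl

theorem R_mem_op (k : H₁) : (vec (d.R k) 0 0, vec (k - Complex.I • d.R k) 0 0) ∈ d.op := by
  refine ⟨?_, ?_, ?_⟩
  · change d.R k = d.R (k - Complex.I • d.R k + Complex.I • d.R k)
    rw [sub_add_cancel]
  · exact (map_zero d.W).symm
  · exact (map_zero d.W).symm

theorem W_mem_op (a b : G) : (vec (0 : H₁) (d.W b) (d.W a), vec (0 : H₁) a b) ∈ d.op := by
  refine ⟨?_, rfl, rfl⟩
  change (0 : H₁) = d.R (0 + Complex.I • 0)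
  rw [smul_zero, add_zero, map_zero]

theorem op_symm₁ {f v g w : H₁} (hf : f = d.R (v + Complex.I • f))
    (hg : g = d.R (w + Complex.I • g)) : ⟪v, g⟫_ℂ = ⟪f, w⟫_ℂ := by
  set h := v + Complex.I • f with hh
  set k := w + Complex.I • g with hk
  have h1 : ⟪h, ContinuousLinearMap.adjoint d.R k⟫_ℂ = ⟪f, k⟫_ℂ := by
    rw [ContinuousLinearMap.adjoint_inner_right, ← hf]
  rw [adjoint_R', ← hg, inner_add_right, inner_smul_right,
    ContinuousLinearMap.adjoint_inner_right, ← hf, hh, hk, inner_add_left, inner_add_right,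
    inner_smul_left, inner_smul_right, Complex.conj_I] at h1
  linear_combination h1

theorem mem_op_iff (y w : Space H₁ G) :
    (y, w) ∈ d.op ↔ ∀ x v, (x, v) ∈ d.op → ⟪v, y⟫_ℂ = ⟪x, w⟫_ℂ := by
  constructor
  · intro hy x v hx
    obtain ⟨h1, h2, h3⟩ := d.mem_op.1 hy
    obtain ⟨h1', h2', h3'⟩ := d.mem_op.1 hx
    rw [inner_eq, inner_eq, d.op_symm₁ h1' h1, h2, h3, h2', h3', d.W_symm, d.W_symm]
    ring
  · intro h
    refine d.mem_op.2 ⟨?_, ?_, ?_⟩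
    -- Testing on pairs produced by R gives y = R*(w − iy); the first resolvent identity turns this
    -- into y = R(w + iy).
    · have h1 : y.fst + Complex.I • ContinuousLinearMap.adjoint d.R y.fst
          = ContinuousLinearMap.adjoint d.R w.fst := by
        refine ext_inner_left ℂ fun k => ?_
        have := h _ _ (d.R_mem_op k)
        rw [inner_eq, inner_eq] at this
        simp only [WithLp.toLp_fst, WithLp.toLp_snd, inner_zero_left, add_zero,
          inner_sub_left, inner_smul_left, Complex.conj_I] at this
        rw [inner_add_right, inner_smul_right, ContinuousLinearMap.adjoint_inner_right,
          ContinuousLinearMap.adjoint_inner_right]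
        linear_combination this
      have h2 := d.adjoint_R (w.fst - Complex.I • y.fst)
      have h3 : ContinuousLinearMap.adjoint d.R (w.fst - Complex.I • y.fst) = y.fst := by
        rw [map_sub, map_smul, ← h1, add_sub_cancel_right]
      rw [h3, ← map_smul, ← map_add] at h2
      nth_rewrite 1 [h2]
      congr 1
      module
    · refine ext_inner_left ℂ fun k => ?_
      have := h _ _ (d.W_mem_op k 0)
      rw [inner_eq, inner_eq] at this
      simpa [d.W_symm] using this
    · refine ext_inner_left ℂ fun k => ?_
      have := h _ _ (d.W_mem_op 0 k)
      rw [inner_eq, inner_eq] at this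
      simpa [d.W_symm] using this

-- The fixed-point equation is (S − z)f = h written through R = (S + i)⁻¹.
variable (hres : ∀ z : ℂ, z.im ≠ 0 → ∀ h, ∃ f, f = d.R (h + z • f + Complex.I • f))

/-- The self-adjoint operator with a singular channel given by the block model. -/
def channel : SingularChannel E (Space H₁ G) where
  op := d.op
  op_single := by
    intro w hw
    obtain ⟨h1, h2, h3⟩ := d.mem_op.1 hw
    have e1 := d.R_injective _ h1.symm
    rw [WithLp.zero_fst, smul_zero, add_zero] at e1
    have e2 := d.W_injective _ h2.symm
    have e3 := d.W_injective _ h3.symm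
    exact WithLp.ofLp_injective _ (Prod.ext e1 (WithLp.ofLp_injective _ (Prod.ext e3 e2)))
  mem_op_iff := d.mem_op_iff
  α := vecL d.α 0 0
  β := vecL d.β d.γ 0
  β_singular := fun e w hw => d.γ_singular e _ (d.mem_op.1 hw).2.1
  Q₀ := d.Q₀
  Q₀_symm := d.Q₀_symm
  -- The off-diagonal operator exchanges the two copies of G, so F keeps the second coordinate and
  -- F' the third.
  F := vecL (fstL H₁ G) (sndL H₁ G) 0
  F' := vecL (fstL H₁ G) 0 (trdL H₁ G)
  F_idem := fun x => rfl
  F_symm := fun x y => by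
    rw [inner_eq, inner_eq]
    simp [vecL, fstL, sndL]
  F'_symm := fun x y => by
    rw [inner_eq, inner_eq]
    simp [vecL, fstL, trdL]
  F_op := by
    intro x v hx
    obtain ⟨h1, h2, h3⟩ := d.mem_op.1 hx
    exact d.mem_op.2 ⟨h1, h2, (map_zero d.W).symm⟩
  F_β := fun e => rfl
  F'_α := fun e => rfl
  pencil_injective := by
    intro z hz x hx
    obtain ⟨h1, h2, h3⟩ := d.mem_op.1 hx
    have e2 : x.snd.fst = 0 := by
      refine h2.trans ?_
      rw [show (z • vecL (fstL H₁ G) (sndL H₁ G) 0 x).snd.snd = z • (0 : G) from rfl, smul_zero,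
        map_zero]
    have e3 : x.snd.snd = 0 := by
      refine h3.trans ?_
      rw [show (z • vecL (fstL H₁ G) (sndL H₁ G) 0 x).snd.fst = z • x.snd.fst from rfl, e2,
        smul_zero, map_zero]
    have h4 : ⟪z • x.fst, x.fst⟫_ℂ = ⟪x.fst, z • x.fst⟫_ℂ := d.op_symm₁ h1 h1
    rw [inner_smul_left, inner_smul_right, ← sub_eq_zero, ← sub_mul] at h4
    have e1 : x.fst = 0 := by
      refine inner_self_eq_zero.1 ((mul_eq_zero.1 h4).resolve_left fun h0 => hz ?_)
      exact Complex.conj_eq_iff_im.1 (sub_eq_zero.1 h0)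
    exact WithLp.ofLp_injective _ (Prod.ext e1 (WithLp.ofLp_injective _ (Prod.ext e2 e3)))
  pencil_surjective := by
    intro z hz h
    obtain ⟨f, hf⟩ := hres z hz h.fst
    refine ⟨vec f (d.W h.snd.snd) (d.W (h.snd.fst + z • d.W h.snd.snd)), d.mem_op.2 ⟨hf, ?_, rfl⟩⟩
    change d.W h.snd.snd = d.W (h.snd.snd + z • (0 : G))
    rw [smul_zero, add_zero]

theorem adjoint_channel_β (x : Space H₁ G) : ContinuousLinearMap.adjoint (d.channel hres).β x
    = ContinuousLinearMap.adjoint d.β x.fst + ContinuousLinearMap.adjoint d.γ x.snd.fst := by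
  refine ext_inner_left ℂ fun e => ?_
  rw [ContinuousLinearMap.adjoint_inner_right, inner_add_right,
    ContinuousLinearMap.adjoint_inner_right, ContinuousLinearMap.adjoint_inner_right, inner_eq]
  change ⟪d.β e, x.fst⟫_ℂ + (⟪d.γ e, x.snd.fst⟫_ℂ + ⟪(0 : G), x.snd.snd⟫_ℂ) = _
  rw [inner_zero_left, add_zero]

theorem adjoint_channel_α (x : Space H₁ G) : ContinuousLinearMap.adjoint (d.channel hres).α x
    = ContinuousLinearMap.adjoint d.α x.fst := by
  refine ext_inner_left ℂ fun e => ?_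
  rw [ContinuousLinearMap.adjoint_inner_right, ContinuousLinearMap.adjoint_inner_right, inner_eq]
  change ⟪d.α e, x.fst⟫_ℂ + (⟪(0 : G), x.snd.fst⟫_ℂ + ⟪(0 : G), x.snd.snd⟫_ℂ) = _
  rw [inner_zero_left, inner_zero_left, add_zero, add_zero]

/-- The Weyl function of the block model. -/
theorem isWeylFunction_channel [FiniteDimensional ℂ E] {V : ℂ → E →L[ℂ] E}
    (hV : ∀ z : ℂ, z.im ≠ 0 → ∀ e f, f = d.R (d.α e + z • d.β e + z • f + Complex.I • f) →
      V z e = ContinuousLinearMap.adjoint d.β (d.α e + z • d.β e + z • f)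
        + ContinuousLinearMap.adjoint d.α f + ContinuousLinearMap.adjoint d.α (d.β e)
        + z • ContinuousLinearMap.adjoint d.γ (d.γ e) + d.Q₀ e) :
    (d.channel hres).IsWeylFunction V := by
  refine SingularChannel.IsWeylFunction.of_exists fun z hz e => ?_
  obtain ⟨f, hf⟩ := hres z hz (d.α e + z • d.β e)
  -- In G ⊕ G the required image is (zγe, 0), so the vector is (0, W(zγe)). F does not see its third
  -- coordinate, and γ* applied to the image gives zγ*γe.
  refine ⟨vec f 0 (d.W (z • d.γ e)), vec (d.α e + z • d.β e + z • f) (z • d.γ e) 0,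
    d.mem_op.2 ⟨hf, (map_zero d.W).symm, rfl⟩, ?_, ?_⟩
  · refine WithLp.ofLp_injective _ (Prod.ext ?_ (WithLp.ofLp_injective _ (Prod.ext ?_ ?_)))
    · change d.α e + z • d.β e + z • f - d.α e = z • (f + d.β e)
      module
    · change z • d.γ e - 0 = z • (0 + d.γ e)
      module
    · change (0 : G) - 0 = z • 0
      module
  · rw [SingularChannel.chan_apply, adjoint_channel_β, adjoint_channel_α, adjoint_channel_α,
      hV z hz e f hf]
    change ContinuousLinearMap.adjoint d.β (d.α e + z • d.β e + z • f)
      + ContinuousLinearMap.adjoint d.γ (z • d.γ e) + ContinuousLinearMap.adjoint d.α f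
      + ContinuousLinearMap.adjoint d.α (d.β e) + d.Q₀ e = _
    rw [map_smul (ContinuousLinearMap.adjoint d.γ)]
    abel

end BlockData

/-! ### Multiplication operators -/

section Multiplication

open scoped BoundedContinuousFunction ENNReal

variable {E : Type u} [NormedAddCommGroup E] [InnerProductSpace ℂ E] {μ : Measure ℝ}

theorem memLp_mul (f : ℝ →ᵇ ℂ) (g : Lp E 2 μ) : MemLp (fun t => f t • g t) 2 μ := by
  refine MemLp.of_le_mul (c := ‖f‖) (Lp.memLp g)
    (f.continuous.aestronglyMeasurable.smul (Lp.aestronglyMeasurable g))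
    (Filter.Eventually.of_forall fun t => ?_)
  rw [norm_smul]
  gcongr
  exact f.norm_coe_le_norm t

/-- Multiplication by a bounded continuous function, as a linear map. -/
def mulLin (f : ℝ →ᵇ ℂ) : Lp E 2 μ →ₗ[ℂ] Lp E 2 μ where
  toFun g := (memLp_mul f g).toLp _
  map_add' g h := by
    refine Lp.ext ?_
    filter_upwards [(memLp_mul f (g + h)).coeFn_toLp, (memLp_mul f g).coeFn_toLp,
      (memLp_mul f h).coeFn_toLp, Lp.coeFn_add g h,
      Lp.coeFn_add ((memLp_mul f g).toLp _) ((memLp_mul f h).toLp _)] with t h1 h2 h3 h4 h5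
    rw [h1, h5, Pi.add_apply, h2, h3, h4, Pi.add_apply, smul_add]
  map_smul' c g := by
    refine Lp.ext ?_
    filter_upwards [(memLp_mul f (c • g)).coeFn_toLp, (memLp_mul f g).coeFn_toLp,
      Lp.coeFn_smul c g, Lp.coeFn_smul c ((memLp_mul f g).toLp _)] with t h1 h2 h3 h4
    rw [h1, RingHom.id_apply, h4, Pi.smul_apply, h2, h3, Pi.smul_apply, smul_comm]

theorem coeFn_mulLin (f : ℝ →ᵇ ℂ) (g : Lp E 2 μ) : mulLin f g =ᵐ[μ] fun t => f t • g t :=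
  (memLp_mul f g).coeFn_toLp

/-- Multiplication by a bounded continuous function. -/
def mulCLM (f : ℝ →ᵇ ℂ) : Lp E 2 μ →L[ℂ] Lp E 2 μ :=
  (mulLin f).mkContinuous ‖f‖ fun g => by
    refine Lp.norm_le_mul_norm_of_ae_le_mul ?_
    filter_upwards [coeFn_mulLin f g] with t h
    rw [h, norm_smul]
    gcongr
    exact f.norm_coe_le_norm t

theorem coeFn_mulCLM (f : ℝ →ᵇ ℂ) (g : Lp E 2 μ) : mulCLM f g =ᵐ[μ] fun t => f t • g t :=
  coeFn_mulLin f g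

theorem mulCLM_mul (f h : ℝ →ᵇ ℂ) (g : Lp E 2 μ) :
    mulCLM (f * h) g = mulCLM f (mulCLM h g) := by
  refine Lp.ext ?_
  filter_upwards [coeFn_mulCLM (f * h) g, coeFn_mulCLM f (mulCLM h g), coeFn_mulCLM h g]
    with t h1 h2 h3
  rw [h1, h2, h3, BoundedContinuousFunction.mul_apply, mul_smul]

theorem mulCLM_add (f h : ℝ →ᵇ ℂ) (g : Lp E 2 μ) :
    mulCLM (f + h) g = mulCLM f g + mulCLM h g := by
  refine Lp.ext ?_
  filter_upwards [coeFn_mulCLM (f + h) g, coeFn_mulCLM f g, coeFn_mulCLM h g,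
    Lp.coeFn_add (mulCLM f g) (mulCLM h g)] with t h1 h2 h3 h4
  rw [h1, h4, Pi.add_apply, h2, h3, BoundedContinuousFunction.add_apply, add_smul]

theorem mulCLM_smul (c : ℂ) (f : ℝ →ᵇ ℂ) (g : Lp E 2 μ) :
    mulCLM (c • f) g = c • mulCLM f g := by
  refine Lp.ext ?_
  filter_upwards [coeFn_mulCLM (c • f) g, coeFn_mulCLM f g,
    Lp.coeFn_smul c (mulCLM f g)] with t h1 h2 h3
  rw [h1, h3, Pi.smul_apply, h2, BoundedContinuousFunction.smul_apply, smul_eq_mul, mul_smul]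

theorem inner_mulCLM (f : ℝ →ᵇ ℂ) (g h : Lp E 2 μ) :
    ⟪g, mulCLM f h⟫_ℂ = ∫ t, f t * ⟪g t, h t⟫_ℂ ∂μ := by
  rw [L2.inner_def]
  refine integral_congr_ae ?_
  filter_upwards [coeFn_mulCLM f h] with t h1
  rw [h1, inner_smul_right]

theorem inner_mulCLM_left (f : ℝ →ᵇ ℂ) (g h : Lp E 2 μ) :
    ⟪mulCLM f g, h⟫_ℂ = ⟪g, mulCLM (star f) h⟫_ℂ := by
  rw [L2.inner_def, L2.inner_def]
  refine integral_congr_ae ?_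
  filter_upwards [coeFn_mulCLM f g, coeFn_mulCLM (star f) h] with t h1 h2
  rw [h1, h2, inner_smul_right, inner_smul_left]
  rfl

theorem adjoint_mulCLM [CompleteSpace E] (f : ℝ →ᵇ ℂ) :
    ContinuousLinearMap.adjoint (mulCLM f : Lp E 2 μ →L[ℂ] Lp E 2 μ) = mulCLM (star f) := by
  refine ((ContinuousLinearMap.eq_adjoint_iff _ _).2 fun g h => ?_).symm
  rw [inner_mulCLM_left, star_star]

theorem mulCLM_eq_zero {f : ℝ →ᵇ ℂ} (hf : ∀ᵐ t ∂μ, f t ≠ 0) {g : Lp E 2 μ}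
    (h : mulCLM f g = 0) : g = 0 := by
  refine Lp.ext ?_
  have h0 := coeFn_mulCLM f g
  rw [h] at h0
  filter_upwards [hf, h0, Lp.coeFn_zero E 2 μ] with t h1 h2 h3
  rw [h3] at h2 ⊢
  exact (smul_eq_zero.1 h2.symm).resolve_left h1

end Multiplication

/-! ### Bounded continuous symbols -/

section Symbols

open scoped BoundedContinuousFunction

theorem sub_ne_zero_of_im_ne_zero {z : ℂ} (hz : z.im ≠ 0) (t : ℝ) : (t : ℂ) - z ≠ 0 := by
  intro h
  have := congrArg Complex.im h
  simp at this
  exact hz this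

/-- The symbol `1 / (t - z)`. -/
def resolventSymbol (z : ℂ) (hz : z.im ≠ 0) : ℝ →ᵇ ℂ :=
  BoundedContinuousFunction.ofNormedAddCommGroup (fun t : ℝ => ((t : ℂ) - z)⁻¹)
    ((Complex.continuous_ofReal.sub continuous_const).inv₀ (sub_ne_zero_of_im_ne_zero hz))
    |z.im|⁻¹ fun t => by
      rw [norm_inv]
      refine inv_anti₀ (abs_pos.2 hz) ?_
      have := Complex.abs_im_le_norm ((t : ℂ) - z)
      simpa using this

theorem sqrt_pos_aux (t : ℝ) : 0 < √(1 + t ^ 2) := Real.sqrt_pos.2 (by positivity)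

/-- The symbol `1 / √(1 + t²)`. -/
def weightSymbol : ℝ →ᵇ ℂ :=
  BoundedContinuousFunction.ofNormedAddCommGroup (fun t : ℝ => ((1 / √(1 + t ^ 2) : ℝ) : ℂ))
    (Complex.continuous_ofReal.comp (continuous_const.div (by fun_prop)
      fun t => (sqrt_pos_aux t).ne')) 1 fun t => by
      rw [Complex.norm_real, Real.norm_eq_abs, abs_of_nonneg (by positivity),
        div_le_one (sqrt_pos_aux t)]
      exact Real.one_le_sqrt.2 (by nlinarith)

/-- The symbol `t / √(1 + t²)`. -/
def positionSymbol : ℝ →ᵇ ℂ :=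
  BoundedContinuousFunction.ofNormedAddCommGroup (fun t : ℝ => ((t / √(1 + t ^ 2) : ℝ) : ℂ))
    (Complex.continuous_ofReal.comp (continuous_id.div (by fun_prop)
      fun t => (sqrt_pos_aux t).ne')) 1 fun t => by
      rw [Complex.norm_real, Real.norm_eq_abs, abs_div, abs_of_pos (sqrt_pos_aux t),
        div_le_one (sqrt_pos_aux t)]
      exact Real.abs_le_sqrt (by linarith)

theorem star_weightSymbol : star weightSymbol = weightSymbol := by
  ext t
  exact Complex.conj_ofReal _

theorem star_positionSymbol : star positionSymbol = positionSymbol := by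
  ext t
  exact Complex.conj_ofReal _

theorem neg_I_im_ne_zero : (-Complex.I).im ≠ 0 := by simp

theorem star_resolventSymbol_eq : star (resolventSymbol (-Complex.I) neg_I_im_ne_zero)
    = resolventSymbol (-Complex.I) neg_I_im_ne_zero
      + (2 * Complex.I) • (resolventSymbol (-Complex.I) neg_I_im_ne_zero *
        star (resolventSymbol (-Complex.I) neg_I_im_ne_zero)) := by
  ext t
  have h1 : (t : ℂ) + Complex.I ≠ 0 := by
    simpa using sub_ne_zero_of_im_ne_zero neg_I_im_ne_zero t
  have h2 : (t : ℂ) - Complex.I ≠ 0 := sub_ne_zero_of_im_ne_zero (by simp) t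
  change conj (((t : ℂ) - -Complex.I)⁻¹) = ((t : ℂ) - -Complex.I)⁻¹
    + (2 * Complex.I) * (((t : ℂ) - -Complex.I)⁻¹ * conj (((t : ℂ) - -Complex.I)⁻¹))
  rw [map_inv₀, map_sub, map_neg, Complex.conj_I, Complex.conj_ofReal, neg_neg, sub_neg_eq_add]
  field_simp
  ring

theorem resolventSymbol_eq {z : ℂ} (hz : z.im ≠ 0) : resolventSymbol z hz
    = resolventSymbol (-Complex.I) neg_I_im_ne_zero
      + (z + Complex.I) •
        (resolventSymbol (-Complex.I) neg_I_im_ne_zero * resolventSymbol z hz) := by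
  ext t
  have h1 : (t : ℂ) + Complex.I ≠ 0 := by
    simpa using sub_ne_zero_of_im_ne_zero neg_I_im_ne_zero t
  have h2 := sub_ne_zero_of_im_ne_zero hz t
  change ((t : ℂ) - z)⁻¹ = ((t : ℂ) - -Complex.I)⁻¹
    + (z + Complex.I) * (((t : ℂ) - -Complex.I)⁻¹ * ((t : ℂ) - z)⁻¹)
  rw [sub_neg_eq_add]
  field_simp
  ring

/-- The symbol of the Nevanlinna kernel relative to the weight `1 / (1 + t²)`. -/
def nevanlinnaSymbol (z : ℂ) (hz : z.im ≠ 0) : ℝ →ᵇ ℂ :=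
  (weightSymbol + z • positionSymbol) *
    (positionSymbol + resolventSymbol z hz * (weightSymbol + z • positionSymbol))

/-- The symbol is (1 + zt)/(t − z); its factored form matches the boundary value β*(α + zβ + zf) +
α*f of the model. -/
theorem nevanlinnaSymbol_div {z : ℂ} (hz : z.im ≠ 0) (t : ℝ) :
    nevanlinnaSymbol z hz t * (1 / (1 + (t : ℂ) ^ 2))
      = 1 / ((t : ℂ) - z) - (t : ℂ) / (1 + (t : ℂ) ^ 2) := by
  have h2 := sub_ne_zero_of_im_ne_zero hz t
  have h3 : ((√(1 + t ^ 2) : ℝ) : ℂ) ≠ 0 := by exact_mod_cast (sqrt_pos_aux t).ne'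
  have h4 : ((√(1 + t ^ 2) : ℝ) : ℂ) ^ 2 = 1 + (t : ℂ) ^ 2 := by
    rw [← Complex.ofReal_pow, Real.sq_sqrt (by positivity)]
    push_cast
    rfl
  change (((1 / √(1 + t ^ 2) : ℝ) : ℂ) + z * ((t / √(1 + t ^ 2) : ℝ) : ℂ)) *
    (((t / √(1 + t ^ 2) : ℝ) : ℂ) + ((t : ℂ) - z)⁻¹ * (((1 / √(1 + t ^ 2) : ℝ) : ℂ)
      + z * ((t / √(1 + t ^ 2) : ℝ) : ℂ))) * (1 / (1 + (t : ℂ) ^ 2)) = _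
  rw [← h4]
  push_cast
  field_simp
  rw [h4]
  ring

end Symbols

/-! ### Recovering an operator measure from its quadratic forms -/

section Polarization

variable {E : Type u} [NormedAddCommGroup E] [InnerProductSpace ℂ E]

theorem inner_apply_eq_sum_quad (O : E →L[ℂ] E) (x y : E) : ⟪x, O y⟫_ℂ
    = ∑ k : Fin 4, (-Complex.I) ^ (k : ℕ) / 4 *
      ⟪x + Complex.I ^ (k : ℕ) • y, O (x + Complex.I ^ (k : ℕ) • y)⟫_ℂ := by
  simp only [Fin.sum_univ_four, map_add, map_smul, inner_add_left, inner_add_right,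
    inner_smul_left, inner_smul_right, map_pow, Complex.conj_I]
  simp only [Fin.val_zero, Fin.val_one, Fin.val_two, show ((3 : Fin 4) : ℕ) = 3 from rfl, pow_zero,
    pow_one, Complex.I_sq, Complex.I_pow_three, neg_sq, Odd.neg_pow (by decide : Odd 3)]
  linear_combination ((1 : ℂ) / 2 * ⟪x, O y⟫_ℂ - 1 / 2 * ⟪y, O x⟫_ℂ) * Complex.I_sq

/-- Every quadratic form of an operator is a combination of finitely many fixed ones. -/
theorem exists_quad_eq_sum [FiniteDimensional ℂ E] : ∃ (ι : Type) (_ : Fintype ι) (y : ι → E)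
    (Θ : ι → E →L[ℂ] E), ∀ (O : E →L[ℂ] E) (x : E),
      ⟪x, O x⟫_ℂ = ∑ a, ⟪x, Θ a x⟫_ℂ * ⟪y a, O (y a)⟫_ℂ := by
  let b := stdOrthonormalBasis ℂ E
  refine ⟨Fin _ × Fin _ × Fin 4, inferInstance,
    -- Polarization vectors of an orthonormal basis; Θ is the matching matrix unit with its
    -- polarization coefficient.
    fun a => b a.1 + Complex.I ^ (a.2.2 : ℕ) • b a.2.1,
    fun a => ((-Complex.I) ^ (a.2.2 : ℕ) / 4) • (innerSL ℂ (b a.2.1)).smulRight (b a.1),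
    fun O x => ?_⟩
  have h : ⟪x, O x⟫_ℂ = ∑ i, ∑ j, ⟪x, b i⟫_ℂ * (⟪b j, x⟫_ℂ * ⟪b i, O (b j)⟫_ℂ) := by
    rw [← b.sum_inner_mul_inner x (O x)]
    refine Finset.sum_congr rfl fun i _ => ?_
    rw [← Finset.mul_sum]
    congr 1
    conv_lhs => rw [← b.sum_repr' x, map_sum, inner_sum]
    exact Finset.sum_congr rfl fun j _ => by rw [map_smul, inner_smul_right]
  rw [h, Fintype.sum_prod_type]
  refine Finset.sum_congr rfl fun i _ => ?_
  rw [Fintype.sum_prod_type]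
  refine Finset.sum_congr rfl fun j _ => ?_
  rw [inner_apply_eq_sum_quad, Finset.mul_sum, Finset.mul_sum]
  refine Finset.sum_congr rfl fun k _ => ?_
  simp only [smul_apply, ContinuousLinearMap.smulRight_apply, innerSL_apply_apply, inner_smul_right]
  ring

end Polarization

/-! ### Linear relations between Stieltjes measures -/

section StieltjesSums

open Filter Topology
open scoped NNReal

variable {ι : Type*} [Fintype ι]

/-- A linear relation between monotone functions passes to right limits, hence to the measures of
half-open intervals. Splitting coefficients by sign keeps both sides nonnegative measures. -/
theorem sum_smul_stieltjes_measure {q : ι → ℝ → ℝ} (hq : ∀ a, Monotone (q a)) {r : ι → ℝ}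
    (h : ∀ t, ∑ a, r a * q a t = 0) :
    ∑ a, (r a).toNNReal • (hq a).stieltjesFunction.measure
      = ∑ a, (-r a).toNNReal • (hq a).stieltjesFunction.measure := by
  have hR : ∀ t, ∑ a, r a * (hq a).stieltjesFunction t = 0 := by
    intro t
    have h1 : Tendsto (fun s => ∑ a, r a * q a s) (𝓝[>] t)
        (𝓝 (∑ a, r a * (hq a).stieltjesFunction t)) := by
      refine tendsto_finsetSum _ fun a _ => Tendsto.const_mul _ ?_
      rw [(hq a).stieltjesFunction_eq]
      exact (hq a).tendsto_rightLim t
    simp only [h] at h1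
    exact tendsto_nhds_unique h1 tendsto_const_nhds
  have hval : ∀ (c : ι → ℝ≥0) (x y : ℝ), x < y →
      (∑ a, c a • (hq a).stieltjesFunction.measure) (Set.Ioc x y)
      = ENNReal.ofReal (∑ a, (c a : ℝ) * ((hq a).stieltjesFunction y
        - (hq a).stieltjesFunction x)) := by
    intro c x y hxy
    rw [Measure.finsetSum_apply, ENNReal.ofReal_sum_of_nonneg (fun a _ => by
      exact mul_nonneg (c a).coe_nonneg (sub_nonneg.2 ((hq a).stieltjesFunction.mono hxy.le)))]
    refine Finset.sum_congr rfl fun a _ => ?_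
    rw [Measure.smul_apply, StieltjesFunction.measure_Ioc, ENNReal.ofReal_mul (c a).coe_nonneg,
      ENNReal.ofReal_coe_nnreal]
    rfl
  refine Measure.ext_of_Ioc' _ _ (fun x y hxy => ?_) fun x y hxy => ?_
  · rw [hval _ x y hxy]
    exact ENNReal.ofReal_ne_top
  · rw [hval _ x y hxy, hval _ x y hxy]
    congr 1
    rw [← sub_eq_zero, ← Finset.sum_sub_distrib]
    have : ∀ a, ((r a).toNNReal : ℝ) * ((hq a).stieltjesFunction y - (hq a).stieltjesFunction x)
        - ((-r a).toNNReal : ℝ) * ((hq a).stieltjesFunction y - (hq a).stieltjesFunction x)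
        = r a * (hq a).stieltjesFunction y - r a * (hq a).stieltjesFunction x := by
      intro a
      rw [← sub_mul, Real.coe_toNNReal', Real.coe_toNNReal', max_zero_sub_eq_self, mul_sub]
    simp only [this, Finset.sum_sub_distrib, hR, sub_zero]

theorem sum_mul_integral_stieltjes {q : ι → ℝ → ℝ} (hq : ∀ a, Monotone (q a)) {r : ι → ℝ}
    (h : ∀ t, ∑ a, r a * q a t = 0) {f : ℝ → ℂ}
    (hf : ∀ a, Integrable f (hq a).stieltjesFunction.measure) :
    ∑ a, (r a : ℂ) * ∫ t, f t ∂(hq a).stieltjesFunction.measure = 0 := by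
  have hI : ∀ c : ι → ℝ≥0, ∫ t, f t ∂(∑ a, c a • (hq a).stieltjesFunction.measure)
      = ∑ a, ((c a : ℝ) : ℂ) * ∫ t, f t ∂(hq a).stieltjesFunction.measure := by
    intro c
    rw [integral_finsetSum_measure fun a _ => (hf a).smul_measure_nnreal]
    refine Finset.sum_congr rfl fun a _ => ?_
    rw [integral_smul_nnreal_measure, NNReal.smul_def, Complex.real_smul]
  have h1 := hI fun a => (r a).toNNReal
  rw [sum_smul_stieltjes_measure hq h, hI, eq_comm, ← sub_eq_zero, ← Finset.sum_sub_distrib] at h1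
  rw [← h1]
  refine Finset.sum_congr rfl fun a _ => ?_
  rw [← sub_mul, ← Complex.ofReal_sub, Real.coe_toNNReal', Real.coe_toNNReal', max_zero_sub_eq_self]

end StieltjesSums

section Density

variable {E : Type u} [NormedAddCommGroup E] [InnerProductSpace ℂ E] {ι : Type} [Fintype ι]

theorem MonotoneOperatorFunction.inner_eq_ofReal (S : MonotoneOperatorFunction E) (t : ℝ) (x : E) :
    ⟪x, S.toFun t x⟫_ℂ = ((⟪x, S.toFun t x⟫_ℂ).re : ℂ) := by
  refine (Complex.conj_eq_iff_re.1 ?_).symm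
  rw [inner_conj_symm]
  exact S.symm t x x

theorem MonotoneOperatorFunction.integral_quadMeasure_eq_sum (S : MonotoneOperatorFunction E)
    {y : ι → E} {Θ : ι → E →L[ℂ] E} (hpol : ∀ (O : E →L[ℂ] E) (x : E),
      ⟪x, O x⟫_ℂ = ∑ a, ⟪x, Θ a x⟫_ℂ * ⟪y a, O (y a)⟫_ℂ) {f : ℝ → ℂ}
    (hf : ∀ x, Integrable f (S.quadMeasure x)) (x : E) :
    ∫ t, f t ∂(S.quadMeasure x) = ∑ a, ⟪x, Θ a x⟫_ℂ * ∫ t, f t ∂(S.quadMeasure (y a)) := by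
  have hpt : ∀ t, ((⟪x, S.toFun t x⟫_ℂ).re : ℂ)
      = ∑ a, ⟪x, Θ a x⟫_ℂ * ((⟪y a, S.toFun t (y a)⟫_ℂ).re : ℂ) := by
    intro t
    rw [← S.inner_eq_ofReal, hpol]
    exact Finset.sum_congr rfl fun a _ => by rw [← S.inner_eq_ofReal]
  -- The extra index carries x with coefficient −1, making the real part of the relation a vanishing
  -- sum; the imaginary part needs no such term.
  let p : Option ι → E := fun a => a.elim x y
  have hre := sum_mul_integral_stieltjes (fun a => S.monotone_quad (p a))
    (r := fun a => a.elim (-1) fun a => (⟪x, Θ a x⟫_ℂ).re) (fun t => by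
      have := congrArg Complex.re (hpt t)
      simp only [Complex.ofReal_re, Complex.re_sum, Complex.re_mul_ofReal] at this
      rw [Fintype.sum_option]
      simp only [p, Option.elim]
      rw [this]
      ring) (f := f) fun a => hf _
  have him := sum_mul_integral_stieltjes (fun a => S.monotone_quad (y a))
    (r := fun a => (⟪x, Θ a x⟫_ℂ).im) (fun t => by
      have := congrArg Complex.im (hpt t)
      simpa only [Complex.ofReal_im, Complex.im_sum, Complex.im_mul_ofReal, eq_comm] using this)
      (f := f) fun a => hf _
  rw [Fintype.sum_option] at hre
  simp only [p, Option.elim] at hre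
  have hsplit : ∑ a, ⟪x, Θ a x⟫_ℂ * ∫ t, f t ∂(S.quadMeasure (y a))
      = ∑ a, ((⟪x, Θ a x⟫_ℂ).re : ℂ) * ∫ t, f t ∂(S.quadMeasure (y a))
        + Complex.I * ∑ a, ((⟪x, Θ a x⟫_ℂ).im : ℂ) * ∫ t, f t ∂(S.quadMeasure (y a)) := by
    rw [Finset.mul_sum, ← Finset.sum_add_distrib]
    refine Finset.sum_congr rfl fun a _ => ?_
    conv_lhs => rw [← Complex.re_add_im ⟪x, Θ a x⟫_ℂ]
    ring
  change ((-1 : ℝ) : ℂ) * (∫ t, f t ∂(S.quadMeasure x))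
    + ∑ a, ((⟪x, Θ a x⟫_ℂ).re : ℂ) * ∫ t, f t ∂(S.quadMeasure (y a)) = 0 at hre
  change ∑ a, ((⟪x, Θ a x⟫_ℂ).im : ℂ) * ∫ t, f t ∂(S.quadMeasure (y a)) = 0 at him
  rw [hsplit, him, mul_zero, add_zero]
  push_cast at hre
  linear_combination -hre

end Density

/-! ### The finite measures (dΣ x, x)/(1 + t²) -/

section WeightedMeasure

variable {E : Type u} [NormedAddCommGroup E] [InnerProductSpace ℂ E]

/-- The measure `(dΣ(t) x, x) / (1 + t²)`. -/
def MonotoneOperatorFunction.weightedMeasure (S : MonotoneOperatorFunction E) (x : E) :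
    Measure ℝ :=
  (S.quadMeasure x).withDensity fun t => ENNReal.ofReal (1 / (1 + t ^ 2))

variable {S : MonotoneOperatorFunction E}

theorem MonotoneOperatorFunction.IsNevanlinna.isFiniteMeasure (hS : S.IsNevanlinna) (x : E) :
    IsFiniteMeasure (S.weightedMeasure x) :=
  isFiniteMeasure_withDensity_ofReal (hS x).2

theorem toReal_ofReal_weight (t : ℝ) :
    (ENNReal.ofReal (1 / (1 + t ^ 2))).toReal = 1 / (1 + t ^ 2) :=
  ENNReal.toReal_ofReal (by positivity)

theorem measurable_weight : Measurable fun t : ℝ => ENNReal.ofReal (1 / (1 + t ^ 2)) := by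
  fun_prop

theorem integral_weightedMeasure (f : ℝ → ℂ) (x : E) :
    ∫ t, f t ∂(S.weightedMeasure x) = ∫ t, f t * (1 / (1 + (t : ℂ) ^ 2)) ∂(S.quadMeasure x) := by
  rw [MonotoneOperatorFunction.weightedMeasure, integral_withDensity_eq_integral_toReal_smul
    measurable_weight (by simp)]
  refine integral_congr_ae (Filter.Eventually.of_forall fun t => ?_)
  simp only [toReal_ofReal_weight, Complex.real_smul]
  push_cast
  ring

theorem integrable_weightedMeasure_iff {f : ℝ → ℂ} (x : E) :
    Integrable f (S.weightedMeasure x)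
      ↔ Integrable (fun t => f t * (1 / (1 + (t : ℂ) ^ 2))) (S.quadMeasure x) := by
  rw [MonotoneOperatorFunction.weightedMeasure, integrable_withDensity_iff_integrable_smul'
    measurable_weight (by simp)]
  refine integrable_congr (Filter.Eventually.of_forall fun t => ?_)
  simp only [toReal_ofReal_weight, Complex.real_smul]
  push_cast
  ring

theorem integral_weightedMeasure_eq_sum {ι : Type} [Fintype ι]
    {y : ι → E} {Θ : ι → E →L[ℂ] E} (hpol : ∀ (O : E →L[ℂ] E) (x : E),
      ⟪x, O x⟫_ℂ = ∑ a, ⟪x, Θ a x⟫_ℂ * ⟪y a, O (y a)⟫_ℂ) {f : ℝ → ℂ}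
    (hf : ∀ x, Integrable f (S.weightedMeasure x)) (x : E) :
    ∫ t, f t ∂(S.weightedMeasure x)
      = ∑ a, ⟪x, Θ a x⟫_ℂ * ∫ t, f t ∂(S.weightedMeasure (y a)) := by
  simp only [integral_weightedMeasure]
  exact S.integral_quadMeasure_eq_sum hpol (fun x => (integrable_weightedMeasure_iff x).1 (hf x)) x

end WeightedMeasure

/-! ### Matrix density and the L² embedding -/

section Density

variable {E : Type u} [NormedAddCommGroup E] [InnerProductSpace ℂ E]

theorem isPositive_of_inner_nonneg [CompleteSpace E] {M : E →L[ℂ] E}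
    (h : ∀ x, ∃ r : ℝ, 0 ≤ r ∧ ⟪x, M x⟫_ℂ = r) : M.IsPositive := by
  rw [ContinuousLinearMap.isPositive_iff_complex]
  intro x
  obtain ⟨r, hr, h⟩ := h x
  have : ⟪M x, x⟫_ℂ = r := by rw [← inner_conj_symm, h, Complex.conj_ofReal]
  rw [this]
  simpa using hr

/-- A family of finite measures that depends on `x` as a quadratic form has a matrix density. -/
theorem exists_matrix_density [FiniteDimensional ℂ E] [CompleteSpace E] {ι : Type} [Fintype ι]
    {y : ι → E} {Θ : ι → E →L[ℂ] E} {ν : E → Measure ℝ} (hfin : ∀ x, IsFiniteMeasure (ν x))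
    (hν : ∀ f : ℝ → ℂ, (∀ x, Integrable f (ν x)) → ∀ x,
      ∫ t, f t ∂(ν x) = ∑ a, ⟪x, Θ a x⟫_ℂ * ∫ t, f t ∂(ν (y a))) :
    ∃ (θ : Measure ℝ) (_ : IsFiniteMeasure θ) (M : ℝ → E →L[ℂ] E), StronglyMeasurable M ∧
      (∀ᵐ t ∂θ, (M t).IsPositive) ∧ ∀ (f : ℝ → ℂ), (∀ x, Integrable f (ν x)) → ∀ x,
        Integrable (fun t => f t * ⟪x, M t x⟫_ℂ) θ ∧
        ∫ t, f t * ⟪x, M t x⟫_ℂ ∂θ = ∫ t, f t ∂(ν x) := by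
  classical
  let θ : Measure ℝ := ∑ a, ν (y a)
  have hθ : IsFiniteMeasure θ := by infer_instance
  have hac : ∀ a, ν (y a) ≪ θ := by
    intro a
    refine Measure.absolutelyContinuous_of_le ?_
    exact Finset.single_le_sum (f := fun a => ν (y a)) (fun _ _ => Measure.zero_le _)
      (Finset.mem_univ a)
  let d : ι → ℝ → ℝ := fun a t => ((ν (y a)).rnDeriv θ t).toReal
  have hd : ∀ a, Measurable (d a) := fun a => (Measure.measurable_rnDeriv _ _).ennreal_toReal
  let M : ℝ → E →L[ℂ] E := fun t => ∑ a, (d a t : ℂ) • Θ a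
  have hM : StronglyMeasurable M := by
    refine Finset.stronglyMeasurable_fun_sum _ fun a _ => ?_
    exact (Complex.measurable_ofReal.comp (hd a)).stronglyMeasurable.smul_const _
  have hinner : ∀ t x, ⟪x, M t x⟫_ℂ = ∑ a, (d a t : ℂ) * ⟪x, Θ a x⟫_ℂ := by
    intro t x
    simp only [M, sum_apply, smul_apply, inner_sum, inner_smul_right]
  have hint : ∀ f : ℝ → ℂ, (∀ x, Integrable f (ν x)) → ∀ x,
      Integrable (fun t => f t * ⟪x, M t x⟫_ℂ) θ ∧
      ∫ t, f t * ⟪x, M t x⟫_ℂ ∂θ = ∫ t, f t ∂(ν x) := by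
    intro f hf x
    have h1 : ∀ a, Integrable (fun t => ⟪x, Θ a x⟫_ℂ * (d a t • f t)) θ := fun a =>
      ((integrable_rnDeriv_smul_iff (hac a)).2 (hf (y a))).const_mul _
    have h2 : (fun t => f t * ⟪x, M t x⟫_ℂ) = fun t => ∑ a, ⟪x, Θ a x⟫_ℂ * (d a t • f t) := by
      funext t
      rw [hinner, Finset.mul_sum]
      exact Finset.sum_congr rfl fun a _ => by rw [Complex.real_smul]; ring
    rw [h2]
    refine ⟨integrable_finsetSum _ fun a _ => h1 a, ?_⟩
    rw [integral_finsetSum _ fun a _ => h1 a, hν f hf x]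
    refine Finset.sum_congr rfl fun a _ => ?_
    rw [integral_const_mul]
    congr 1
    exact integral_rnDeriv_smul (hac a)
  refine ⟨θ, hθ, M, hM, ?_, hint⟩
  have hone : ∀ s : Set ℝ, MeasurableSet s → ∀ x,
      Integrable (s.indicator fun _ => (1 : ℂ)) (ν x) := fun s hs x =>
    (integrable_const (1 : ℂ)).indicator hs
  have hset : ∀ s : Set ℝ, MeasurableSet s → ∀ x,
      ∫ t in s, ⟪x, M t x⟫_ℂ ∂θ = ((ν x).real s : ℂ) := by
    intro s hs x
    have := (hint _ (hone s hs) x).2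
    rw [integral_indicator hs, setIntegral_const, Complex.real_smul, mul_one] at this
    rw [← this, ← integral_indicator hs]
    refine integral_congr_ae (Filter.Eventually.of_forall fun t => ?_)
    by_cases ht : t ∈ s <;> simp [ht]
  -- For x outside the family `y`, absolute continuity comes from the set identity `hset`.
  have hacx : ∀ x, ν x ≪ θ := by
    intro x
    refine Measure.AbsolutelyContinuous.mk fun s hs h0 => ?_
    have := hset s hs x
    rw [Measure.restrict_eq_zero.2 h0, integral_zero_measure] at this
    exact (measureReal_eq_zero_iff).1 (Complex.ofReal_eq_zero.1 this.symm)
  have hae : ∀ x, ∀ᵐ t ∂θ, ∃ r : ℝ, 0 ≤ r ∧ ⟪x, M t x⟫_ℂ = r := by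
    intro x
    have h1 : Integrable (fun t => ⟪x, M t x⟫_ℂ) θ := by
      simpa using (hint (fun _ => 1) (fun x => integrable_const _) x).1
    have h2 : Integrable (fun t => ((ν x).rnDeriv θ t).toReal • (1 : ℂ)) θ :=
      (integrable_rnDeriv_smul_iff (hacx x)).2 (integrable_const _)
    filter_upwards [h1.ae_eq_of_forall_setIntegral_eq _ _ h2 fun s hs _ => by
      rw [hset s hs, setIntegral_rnDeriv_smul (hacx x) hs, setIntegral_const, Complex.real_smul,
        mul_one]] with t ht
    exact ⟨_, ENNReal.toReal_nonneg, by rw [ht, Complex.real_smul, mul_one]⟩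
  have hprop : ProperSpace E := FiniteDimensional.proper ℂ E
  -- The exceptional null set depends on x; a countable dense set of vectors and closedness of
  -- positivity give a common one.
  filter_upwards [ae_all_iff.2 fun n => hae (TopologicalSpace.denseSeq E n)] with t ht
  refine isPositive_of_inner_nonneg fun x => ?_
  have hclosed : IsClosed {x : E | 0 ≤ (⟪x, M t x⟫_ℂ).re ∧ (⟪x, M t x⟫_ℂ).im = 0} := by
    refine (isClosed_le ?_ ?_).and (isClosed_eq ?_ ?_) <;> fun_prop
  have hx : x ∈ {x : E | 0 ≤ (⟪x, M t x⟫_ℂ).re ∧ (⟪x, M t x⟫_ℂ).im = 0} := by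
    refine hclosed.closure_subset_iff.2 ?_ (TopologicalSpace.denseRange_denseSeq E x)
    rintro _ ⟨n, rfl⟩
    obtain ⟨r, hr, h⟩ := ht n
    simp only [Set.mem_ofPred_eq, h]
    simpa using hr
  exact ⟨_, hx.1, Complex.ext rfl hx.2⟩

/-- The square root is continuous on the closed cone of nonnegative operators and 0 off it. -/
theorem measurable_sqrt_clm [FiniteDimensional ℂ E] [CompleteSpace E] :
    Measurable (CFC.sqrt : (E →L[ℂ] E) → E →L[ℂ] E) := by
  classical
  have hs : IsClosed {a : E →L[ℂ] E | 0 ≤ a} := by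
    have : {a : E →L[ℂ] E | 0 ≤ a}
        = ⋂ x : E, {a | 0 ≤ (⟪a x, x⟫_ℂ).re ∧ (((⟪a x, x⟫_ℂ).re : ℝ) : ℂ) = ⟪a x, x⟫_ℂ} := by
      ext a
      rw [Set.mem_ofPred_eq, ContinuousLinearMap.nonneg_iff_isPositive,
        ContinuousLinearMap.isPositive_iff_complex, Set.mem_iInter]
      exact forall_congr' fun x => and_comm
    rw [this]
    refine isClosed_iInter fun x => (isClosed_le ?_ ?_).and (isClosed_eq ?_ ?_) <;>
      fun_prop
  have h := ContinuousOn.measurable_piecewise (g := fun _ => (0 : E →L[ℂ] E))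
    (CFC.continuousOn_sqrt (A := E →L[ℂ] E)) continuousOn_const hs.measurableSet
  convert h using 1
  funext a
  by_cases ha : a ∈ {a : E →L[ℂ] E | 0 ≤ a}
  · rw [Set.piecewise_eq_of_mem _ _ _ ha]
  · rw [Set.piecewise_eq_of_notMem _ _ _ ha, CFC.sqrt_of_not_nonneg ha]

open scoped BoundedContinuousFunction

/-- The `L²` model of a Nevanlinna operator measure. -/
theorem exists_embedding [FiniteDimensional ℂ E] [CompleteSpace E] {S : MonotoneOperatorFunction E}
    (hS : S.IsNevanlinna) : ∃ (θ : Measure ℝ) (γ : E →L[ℂ] Lp E 2 θ), ∀ (x : E) (f : ℝ →ᵇ ℂ),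
      ⟪γ x, mulCLM f (γ x)⟫_ℂ = ∫ t, f t * (1 / (1 + (t : ℂ) ^ 2)) ∂(S.quadMeasure x) := by
  obtain ⟨ι, _, y, Θ, hpol⟩ := exists_quad_eq_sum (E := E)
  have hfin := hS.isFiniteMeasure
  obtain ⟨θ, hθ, M, hM, hpos, hint⟩ := exists_matrix_density hfin
    fun f hf x => integral_weightedMeasure_eq_sum hpol hf x
  have : ProperSpace (E →L[ℂ] E) := FiniteDimensional.proper ℂ _
  -- The embedding is x ↦ M(t)^{1/2}x, so that pointwise inner products reproduce ⟪x, M(t)x⟫.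
  let C : ℝ → E →L[ℂ] E := fun t => CFC.sqrt (M t)
  have hC : StronglyMeasurable C := (measurable_sqrt_clm.comp hM.measurable).stronglyMeasurable
  have hCe : ∀ e, AEStronglyMeasurable (fun t => C t e) θ := fun e =>
    ((ContinuousLinearMap.apply ℂ E e).continuous.comp_stronglyMeasurable hC).aestronglyMeasurable
  have hsq : ∀ᵐ t ∂θ, ∀ e, ⟪C t e, C t e⟫_ℂ = ⟪e, M t e⟫_ℂ := by
    filter_upwards [hpos] with t ht e
    have h0 : 0 ≤ M t := (ContinuousLinearMap.nonneg_iff_isPositive _).2 ht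
    have h1 : (C t).IsPositive :=
      (ContinuousLinearMap.nonneg_iff_isPositive _).1 (CFC.sqrt_nonneg _)
    refine (h1.isSymmetric e (C t e)).trans ?_
    change ⟪e, (C t * C t) e⟫_ℂ = _
    rw [CFC.sqrt_mul_sqrt_self (M t) h0]
  have hmem : ∀ e, MemLp (fun t => C t e) 2 θ := by
    intro e
    rw [memLp_two_iff_integrable_sq_norm (hCe e)]
    have h1 : Integrable (fun t => ⟪e, M t e⟫_ℂ) θ := by
      simpa using (hint (fun _ => 1) (fun x => integrable_const _) e).1
    refine h1.re.congr ?_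
    filter_upwards [hsq] with t ht
    rw [← ht e]
    exact inner_self_eq_norm_sq _
  let γ : E →ₗ[ℂ] Lp E 2 θ :=
    { toFun := fun e => (hmem e).toLp _
      map_add' := fun a b => by
        rw [← MemLp.toLp_add]
        exact MemLp.toLp_congr _ _ (Filter.Eventually.of_forall fun t => map_add (C t) a b)
      map_smul' := fun c a => by
        rw [RingHom.id_apply, ← MemLp.toLp_const_smul]
        exact MemLp.toLp_congr _ _ (Filter.Eventually.of_forall fun t => map_smul (C t) c a) }
  refine ⟨θ, LinearMap.toContinuousLinearMap γ, fun x f => ?_⟩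
  have hf : ∀ x, Integrable (fun t => f t) (S.weightedMeasure x) := fun x =>
    f.integrable _
  rw [inner_mulCLM, ← integral_weightedMeasure, ← (hint f hf x).2]
  refine integral_congr_ae ?_
  filter_upwards [hsq, (hmem x).coeFn_toLp] with t ht h1
  have h2 : (LinearMap.toContinuousLinearMap γ x : ℝ → E) t = C t x := h1
  rw [h2, ht]

end Density

/-! ### The model space -/

section SingularPart

variable {E : Type u} [NormedAddCommGroup E] [InnerProductSpace ℂ E]

/-- Lebesgue measure on `(0, 1]`. -/
abbrev unitMeasure : Measure ℝ := volume.restrict (Set.Ioc 0 1)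

instance : IsFiniteMeasure unitMeasure := ⟨by simp⟩

theorem weight_mul_position_apply (t : ℝ) :
    (weightSymbol * positionSymbol) t = ((t / (1 + t ^ 2) : ℝ) : ℂ) := by
  have h : √(1 + t ^ 2) * √(1 + t ^ 2) = 1 + t ^ 2 := Real.mul_self_sqrt (by positivity)
  change ((1 / √(1 + t ^ 2) : ℝ) : ℂ) * ((t / √(1 + t ^ 2) : ℝ) : ℂ) = _
  rw [← Complex.ofReal_mul, div_mul_div_comm, one_mul, h]

theorem weight_mul_position_ne_zero :
    ∀ᵐ t ∂unitMeasure, (weightSymbol * positionSymbol) t ≠ 0 := by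
  filter_upwards [ae_restrict_mem measurableSet_Ioc] with t ht
  rw [weight_mul_position_apply]
  have h0 : 0 < t := ht.1
  exact_mod_cast (by positivity : t / (1 + t ^ 2) ≠ 0)

theorem not_integrable_inv_unitMeasure : ¬ Integrable (fun t : ℝ => t⁻¹) unitMeasure := by
  intro h
  have h1 : IntervalIntegrable (fun t : ℝ => t⁻¹) volume 0 1 :=
    (intervalIntegrable_iff_integrableOn_Ioc_of_le zero_le_one).2 h
  simp [intervalIntegrable_inv_iff] at h1

/-- Nonzero constants are not in the range of multiplication by `t / (1 + t²)`. -/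
theorem eq_zero_of_const_eq_mul {a : E} {g : Lp E 2 unitMeasure}
    (h : Lp.const 2 unitMeasure a = mulCLM (weightSymbol * positionSymbol) g) : a = 0 := by
  by_contra ha
  have hg : Integrable (fun t => g t) unitMeasure := (Lp.memLp g).integrable one_le_two
  -- The equation forces ‖a‖ ≤ t‖g(t)‖, so for a ≠ 0 the function 1/t would be dominated by the
  -- integrable ‖g‖/‖a‖.
  refine not_integrable_inv_unitMeasure ((hg.norm.const_mul ‖a‖⁻¹).mono'
    measurable_inv.aestronglyMeasurable ?_)
  have h1 := coeFn_mulCLM (weightSymbol * positionSymbol) g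
  rw [← h] at h1
  filter_upwards [h1, Lp.coeFn_const (p := 2) (μ := unitMeasure) (c := a),
    ae_restrict_mem measurableSet_Ioc] with t h2 h3 ht
  have h0 : 0 < t := ht.1
  rw [h3, Function.const_apply, weight_mul_position_apply] at h2
  have h4 : ‖a‖ = t / (1 + t ^ 2) * ‖g t‖ := by
    conv_lhs => rw [h2]
    rw [norm_smul, Complex.norm_real, Real.norm_of_nonneg (by positivity)]
  have h5 : ‖a‖ ≤ t * ‖g t‖ := by
    rw [h4]
    gcongr
    exact div_le_self h0.le (by nlinarith)
  have h6 : 0 < ‖a‖ := norm_pos_iff.2 ha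
  rw [Real.norm_of_nonneg (by positivity), inv_mul_eq_div, inv_eq_one_div, div_le_div_iff₀ h0 h6,
    one_mul, mul_comm]
  exact h5

theorem inner_const_const (a b : E) :
    ⟪Lp.const 2 unitMeasure a, Lp.const 2 unitMeasure b⟫_ℂ = ⟪a, b⟫_ℂ := by
  rw [L2.inner_def]
  have : (fun t => ⟪(Lp.const 2 unitMeasure a : ℝ → E) t, (Lp.const 2 unitMeasure b : ℝ → E) t⟫_ℂ)
      =ᵐ[unitMeasure] fun _ => ⟪a, b⟫_ℂ := by
    filter_upwards [Lp.coeFn_const (p := 2) (μ := unitMeasure) (c := a),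
      Lp.coeFn_const (p := 2) (μ := unitMeasure) (c := b)] with t h1 h2
    rw [h1, h2]
    rfl
  rw [integral_congr_ae this, integral_const]
  simp

end SingularPart

/-! ### Resolvents of multiplication by t -/

section Resolvent

variable {E : Type u} [NormedAddCommGroup E] [InnerProductSpace ℂ E] {θ : Measure ℝ}

theorem mulCLM_resolventSymbol_eq {z : ℂ} (hz : z.im ≠ 0) (h : Lp E 2 θ) :
    mulCLM (resolventSymbol z hz) h = mulCLM (resolventSymbol (-Complex.I) neg_I_im_ne_zero)
      (h + z • mulCLM (resolventSymbol z hz) h + Complex.I • mulCLM (resolventSymbol z hz) h) := by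
  conv_lhs => rw [resolventSymbol_eq hz]
  rw [mulCLM_add, mulCLM_smul, mulCLM_mul, map_add, map_add, map_smul, map_smul, add_smul]
  abel

/-- Uniqueness in the fixed-point equation: applying the resolvent identity to h + (z + i)f leaves a
common term that cancels. -/
theorem eq_mulCLM_resolventSymbol {z : ℂ} (hz : z.im ≠ 0) {h f : Lp E 2 θ}
    (hf : f = mulCLM (resolventSymbol (-Complex.I) neg_I_im_ne_zero)
      (h + z • f + Complex.I • f)) : f = mulCLM (resolventSymbol z hz) h := by
  have h1 : mulCLM (resolventSymbol (-Complex.I) neg_I_im_ne_zero)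
      (h + (z + Complex.I) • f) = f := by
    rw [add_smul, ← add_assoc]
    exact hf.symm
  have h2 : mulCLM (resolventSymbol z hz) (h + (z + Complex.I) • f)
      = f + (z + Complex.I) • mulCLM (resolventSymbol z hz) f := by
    conv_lhs => rw [resolventSymbol_eq hz]
    rw [mulCLM_add, mulCLM_smul, mul_comm, mulCLM_mul, h1]
  rw [map_add, map_smul] at h2
  exact (add_right_cancel h2).symm

theorem nevanlinnaSymbol_apply_eq {z : ℂ} (hz : z.im ≠ 0) (g : Lp E 2 θ) :
    mulCLM (nevanlinnaSymbol z hz) g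
      = mulCLM positionSymbol (mulCLM weightSymbol g + z • mulCLM positionSymbol g
        + z • mulCLM (resolventSymbol z hz) (mulCLM weightSymbol g + z • mulCLM positionSymbol g))
      + mulCLM weightSymbol
        (mulCLM (resolventSymbol z hz) (mulCLM weightSymbol g + z • mulCLM positionSymbol g)) := by
  rw [nevanlinnaSymbol, mulCLM_mul, mulCLM_add, mulCLM_add, mulCLM_smul, mulCLM_mul, mulCLM_add,
    mulCLM_smul]
  simp only [map_add, map_smul]
  rw [← mulCLM_mul weightSymbol positionSymbol, mul_comm weightSymbol, mulCLM_mul]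
  module

end Resolvent

/-! ### The concrete model of V -/

section Model

variable {E : Type u} [NormedAddCommGroup E] [InnerProductSpace ℂ E] [CompleteSpace E]
  {θ : Measure ℝ}

/-- The block model of a Nevanlinna function, on `L²(θ) ⊕ L²(0, 1) ⊕ L²(0, 1)`. -/
def nevanlinnaModel (γ : E →L[ℂ] Lp E 2 θ) {Q L : E →L[ℂ] E}
    (hQ : ContinuousLinearMap.adjoint Q = Q) (hL : L.IsPositive) (hLinv : IsUnit L) :
    BlockData E (Lp E 2 θ) (Lp E 2 unitMeasure) where
  R := mulCLM (resolventSymbol (-Complex.I) neg_I_im_ne_zero)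
  adjoint_R := fun x => by
    rw [adjoint_mulCLM, ← mulCLM_mul, ← mulCLM_smul, ← mulCLM_add, ← star_resolventSymbol_eq]
  adjoint_R' := fun x => by
    rw [adjoint_mulCLM, ← mulCLM_mul, mul_comm (star _), ← mulCLM_smul, ← mulCLM_add,
      ← star_resolventSymbol_eq]
  R_injective := fun x => mulCLM_eq_zero (Filter.Eventually.of_forall fun t =>
    inv_ne_zero (sub_ne_zero_of_im_ne_zero neg_I_im_ne_zero t))
  W := mulCLM (weightSymbol * positionSymbol)
  W_symm := fun x y => by
    rw [inner_mulCLM_left, star_mul, star_weightSymbol, star_positionSymbol, mul_comm]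
  W_injective := fun x => mulCLM_eq_zero weight_mul_position_ne_zero
  -- The formal channel vector is tβ + α = √(1+t²)γ, split so that both pieces are bounded.
  α := (mulCLM weightSymbol).comp γ
  β := (mulCLM positionSymbol).comp γ
  γ := (Lp.constL 2 unitMeasure ℂ).comp (CFC.sqrt L)
  γ_singular := fun e x h => by
    have h1 : CFC.sqrt L e = 0 := eq_zero_of_const_eq_mul h
    have h2 : L e = 0 := by
      rw [← CFC.sqrt_mul_sqrt_self L ((ContinuousLinearMap.nonneg_iff_isPositive L).2 hL)]
      change CFC.sqrt L (CFC.sqrt L e) = 0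
      rw [h1, map_zero]
    obtain ⟨U, rfl⟩ := hLinv
    calc e = (U.inv * U.val) e := by rw [U.inv_val]; rfl
      _ = U.inv (U.val e) := rfl
      _ = 0 := by rw [h2, map_zero]
  -- Γ₁ contributes α*β to the constant term; subtracting it leaves Q.
  Q₀ := Q - (ContinuousLinearMap.adjoint ((mulCLM weightSymbol).comp γ)).comp
    ((mulCLM positionSymbol).comp γ)
  Q₀_symm := fun e e' => by
    rw [sub_apply, sub_apply, inner_sub_left, inner_sub_right,
      ContinuousLinearMap.comp_apply _ _ e, ContinuousLinearMap.comp_apply _ _ e',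
      ContinuousLinearMap.adjoint_inner_left, ContinuousLinearMap.adjoint_inner_right]
    congr 1
    · rw [← ContinuousLinearMap.adjoint_inner_left, hQ]
    · simp only [ContinuousLinearMap.comp_apply]
      rw [inner_mulCLM_left, inner_mulCLM_left, star_weightSymbol, star_positionSymbol,
        ← mulCLM_mul, ← mulCLM_mul, mul_comm]

variable (γ : E →L[ℂ] Lp E 2 θ) {Q L : E →L[ℂ] E}
  (hQ : ContinuousLinearMap.adjoint Q = Q) (hL : L.IsPositive) (hLinv : IsUnit L)

theorem nevanlinnaModel_resolvent (z : ℂ) (hz : z.im ≠ 0) (h : Lp E 2 θ) :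
    ∃ f, f = (nevanlinnaModel γ hQ hL hLinv).R (h + z • f + Complex.I • f) :=
  ⟨_, mulCLM_resolventSymbol_eq hz h⟩

theorem inner_nevanlinnaModel_γ (e : E) :
    ⟪(nevanlinnaModel γ hQ hL hLinv).γ e, (nevanlinnaModel γ hQ hL hLinv).γ e⟫_ℂ = ⟪e, L e⟫_ℂ := by
  change ⟪Lp.const 2 unitMeasure (CFC.sqrt L e), Lp.const 2 unitMeasure (CFC.sqrt L e)⟫_ℂ = _
  have h1 : (CFC.sqrt L).IsPositive :=
    (ContinuousLinearMap.nonneg_iff_isPositive _).1 (CFC.sqrt_nonneg _)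
  rw [inner_const_const]
  refine (h1.isSymmetric e (CFC.sqrt L e)).trans ?_
  change ⟪e, (CFC.sqrt L * CFC.sqrt L) e⟫_ℂ = _
  rw [CFC.sqrt_mul_sqrt_self L ((ContinuousLinearMap.nonneg_iff_isPositive L).2 hL)]

/-- The α*β terms cancel, γ*γ supplies L, and the remaining terms assemble into the Nevanlinna
symbol. -/
theorem inner_nevanlinnaModel_weyl {z : ℂ} (hz : z.im ≠ 0) (e : E) {f : Lp E 2 θ}
    (hf : f = mulCLM (resolventSymbol z hz) ((nevanlinnaModel γ hQ hL hLinv).α e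
      + z • (nevanlinnaModel γ hQ hL hLinv).β e)) :
    ⟪e, ContinuousLinearMap.adjoint (nevanlinnaModel γ hQ hL hLinv).β
        ((nevanlinnaModel γ hQ hL hLinv).α e + z • (nevanlinnaModel γ hQ hL hLinv).β e + z • f)
      + ContinuousLinearMap.adjoint (nevanlinnaModel γ hQ hL hLinv).α f
      + ContinuousLinearMap.adjoint (nevanlinnaModel γ hQ hL hLinv).α
        ((nevanlinnaModel γ hQ hL hLinv).β e)
      + z • ContinuousLinearMap.adjoint (nevanlinnaModel γ hQ hL hLinv).γ
        ((nevanlinnaModel γ hQ hL hLinv).γ e) + (nevanlinnaModel γ hQ hL hLinv).Q₀ e⟫_ℂ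
      = ⟪e, Q e⟫_ℂ + z * ⟪e, L e⟫_ℂ + ⟪γ e, mulCLM (nevanlinnaSymbol z hz) (γ e)⟫_ℂ := by
  have hQ₀ : ⟪e, (nevanlinnaModel γ hQ hL hLinv).Q₀ e⟫_ℂ = ⟪e, Q e⟫_ℂ
      - ⟪(nevanlinnaModel γ hQ hL hLinv).α e, (nevanlinnaModel γ hQ hL hLinv).β e⟫_ℂ := by
    rw [← ContinuousLinearMap.adjoint_inner_right, ← inner_sub_right]
    rfl
  rw [inner_add_right, inner_add_right, inner_add_right, inner_add_right, inner_smul_right,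
    ContinuousLinearMap.adjoint_inner_right, ContinuousLinearMap.adjoint_inner_right,
    ContinuousLinearMap.adjoint_inner_right, ContinuousLinearMap.adjoint_inner_right,
    inner_nevanlinnaModel_γ, hQ₀]
  have hβ : ∀ x, ⟪(nevanlinnaModel γ hQ hL hLinv).β e, x⟫_ℂ
      = ⟪γ e, mulCLM positionSymbol x⟫_ℂ := fun x => by
    rw [← star_positionSymbol, ← inner_mulCLM_left]
    rfl
  have hα : ⟪(nevanlinnaModel γ hQ hL hLinv).α e, f⟫_ℂ = ⟪γ e, mulCLM weightSymbol f⟫_ℂ := by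
    rw [← star_weightSymbol, ← inner_mulCLM_left]
    rfl
  have hsum : ⟪γ e, mulCLM (nevanlinnaSymbol z hz) (γ e)⟫_ℂ
      = ⟪γ e, mulCLM positionSymbol ((nevanlinnaModel γ hQ hL hLinv).α e
        + z • (nevanlinnaModel γ hQ hL hLinv).β e + z • f)⟫_ℂ
        + ⟪γ e, mulCLM weightSymbol f⟫_ℂ := by
    rw [hf, nevanlinnaSymbol_apply_eq, inner_add_right]
    rfl
  rw [hsum, hβ, hα]
  ring

/-- The function with the given integral representation is the Weyl function of the model. -/
theorem isWeylFunction_nevanlinnaModel [FiniteDimensional ℂ E] {S : MonotoneOperatorFunction E}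
    {V : ℂ → E →L[ℂ] E} (hrep : HasNevanlinnaRepresentation V Q L S)
    (hγ : ∀ (x : E) (f : BoundedContinuousFunction ℝ ℂ), ⟪γ x, mulCLM f (γ x)⟫_ℂ
      = ∫ t, f t * (1 / (1 + (t : ℂ) ^ 2)) ∂(S.quadMeasure x)) :
    ((nevanlinnaModel γ hQ hL hLinv).channel
      (nevanlinnaModel_resolvent γ hQ hL hLinv)).IsWeylFunction V := by
  refine BlockData.isWeylFunction_channel _ _ fun z hz e f hf => ?_
  set d := nevanlinnaModel γ hQ hL hLinv with hd
  rw [eq_mulCLM_resolventSymbol hz hf]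
  let P : E →L[ℂ] Lp E 2 θ := (mulCLM (resolventSymbol z hz)).comp (d.α + z • d.β)
  let O : E →L[ℂ] E := (ContinuousLinearMap.adjoint d.β).comp (d.α + z • d.β + z • P)
    + (ContinuousLinearMap.adjoint d.α).comp P + (ContinuousLinearMap.adjoint d.α).comp d.β
    + z • (ContinuousLinearMap.adjoint d.γ).comp d.γ + d.Q₀
  suffices h : (V z : E →ₗ[ℂ] E) = O from congrArg (fun T : E →ₗ[ℂ] E => T e) h
  -- Over ℂ an operator is determined by its quadratic form, the only form in which the
  -- representation is given.
  refine (ext_inner_map _ _).1 fun x => ?_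
  rw [← inner_conj_symm, ← inner_conj_symm ((O : E →ₗ[ℂ] E) x)]
  congr 1
  refine (hrep z hz x).trans ?_
  refine Eq.trans ?_ (inner_nevanlinnaModel_weyl γ hQ hL hLinv hz x rfl).symm
  rw [hγ]
  simp only [nevanlinnaSymbol_div]

end Model

end

end FPlusRealization

/-! ### The realization theorem -/

theorem theorem4p2 {E : Type u} [NormedAddCommGroup E] [InnerProductSpace ℂ E]
    [FiniteDimensional ℂ E] [CompleteSpace E]
    (V : ℂ → E →L[ℂ] E) (Q L : E →L[ℂ] E) (S : FPlusRealization.MonotoneOperatorFunction E)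
    (hV : FPlusRealization.IsHerglotzNevanlinna V)
    (hQ : ContinuousLinearMap.adjoint Q = Q) (hL : L.IsPositive) (hLinv : IsUnit L)
    (hS : S.IsNevanlinna) (hrep : FPlusRealization.HasNevanlinnaRepresentation V Q L S) :
    ∃ (H : Type u) (_ : NormedAddCommGroup H) (_ : InnerProductSpace ℂ H) (_ : CompleteSpace H)
      (A : H →ₗ.[ℂ] H) (D B : FPlusRealization.HPlus A →L[ℂ] FPlusRealization.HMinus A)
      (F : H →L[ℂ] H) (K : E →L[ℂ] FPlusRealization.HMinus A),
      -- the scattering system and the impedance system, and the relation between them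
      FPlusRealization.IsScatteringFSystem A B F K ∧
      FPlusRealization.IsDeltaSystem A D F K ∧
      B = D + Complex.I • K.comp (FPlusRealization.chanAdjoint K) ∧
      FPlusRealization.rigReal B = D ∧
      -- the impedance realization
      (∀ z : ℂ, z.im ≠ 0 → z ∈ FPlusRealization.rho D F K ∧
        V z = FPlusRealization.compressedResolvent D F K z) ∧
      -- the transfer function is defined on the lower half-plane and at every nonreal point
      -- where `I + i V(z)` is invertible
      (∀ z : ℂ, z.im < 0 → z ∈ FPlusRealization.rho B F K) ∧
      (∀ z : ℂ, z.im ≠ 0 → IsUnit (1 + Complex.I • V z) → z ∈ FPlusRealization.rho B F K) ∧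
      -- the realization through the transfer function
      (∀ z : ℂ, z.im ≠ 0 → z ∈ FPlusRealization.rho B F K →
        IsUnit (FPlusRealization.transferFunction B F K 1 z + 1) ∧
        V z = Complex.I • (Ring.inverse (FPlusRealization.transferFunction B F K 1 z + 1) *
          (FPlusRealization.transferFunction B F K 1 z - 1))) := by
  obtain ⟨θ, γ, hγ⟩ := FPlusRealization.exists_embedding hS
  have hW := FPlusRealization.isWeylFunction_nevanlinnaModel γ hQ hL hLinv hrep hγ
  set M := (FPlusRealization.nevanlinnaModel γ hQ hL hLinv).channel
    (FPlusRealization.nevanlinnaModel_resolvent γ hQ hL hLinv)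
  exact ⟨_, inferInstance, inferInstance, inferInstance, M.herm, M.rig 0 0, M.rig Complex.I 0, M.F,
    M.chanMinus, M.isScatteringFSystem_rig, M.isDeltaSystem_rig, M.rig_I, M.rigReal_rig,
    fun z hz => ⟨M.mem_rho_of_im_ne_zero hz, hW.impedance_eq hz⟩,
    fun z hz => hW.mem_rho_of_im_neg hV hz, fun z hz h => hW.mem_rho_of_isUnit hz h,
    fun z hz h => hW.transfer_eq hz h⟩
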